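/- **Setting.** Let $A_1,\dots,A_m\in\mathbb R^{n\times n}$ be symmetric, $\mathcal A(M)=(\langle A_k,M\rangle)_k$, $Z\in\mathbb R^{n\times r}$, $M^*=ZZ^\top$, $b=\mathcal A(M^*)$, and let $f(M)=\frac12\|\mathcal A(M)-b\|^2$ satisfy the $(L_s,r)$-RSS property: $f(M)-f(N)\le\langle M-N,\nabla f(N)\rangle+\frac{L_s}{2}\|M-N\|_F^2$ whenever $\operatorname{rank}M,\operatorname{rank}N\le r$. For an order $l\ge1$ consider on tensors $\mathbf w\in\mathbb R^{nr\circ l}$ (cubic of order $l$; each mode index is a pair $(i,s)\in[n]\times[r]$, the index of a vectorized $n\times r$ matrix) the lifted objective $$h^l(\mathbf w)=\sum_{k\in[m]^l}\Big(\sum_{i,j\in[n]^l}\prod_{p=1}^l(A_{k_p})_{i_pj_p}\sum_{s\in[r]^l}\mathbf w_{(i_1,s_1)\dots(i_l,s_l)}\mathbf w_{(j_1,s_1)\dots(j_l,s_l)}-\prod_{p=1}^l b_{k_p}\Big)^2$$ and gradient descent $\mathbf w_{t+1}=\mathbf w_t-\eta\nabla h^l(\mathbf w_t)$, $\mathbf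 w_0=\epsilon x_0^{\otimes l}$, with $\eta>0$, $\epsilon>0$. Put $U=(\sum_k b_kA_k)\otimes I_r\in\mathbb R^{nr\times nr}$ (Kronecker product) and $r_U=\operatorname{rank}U$. Let $\sigma_1(U)\ge\sigma_2(U)$ be the first two singular values of $U$, where the $r$-fold repetition of every singular value that comes from the factor $I_r$ is not counted (so they are the first two singular values of $\sum_kb_kA_k$, with $\sigma_2=0$ if $n=1$; for $r=1$ nothing is changed). Assume $\sigma_1(U)>\sigma_2(U)$, let $v_1$ be any unit singular vector of $U$ for $\sigma_1(U)$, and let $x_0=v_1+g$ with $g\sim\mathcal N(0,\rho I_{nr})$. For $\kappa\in(0,1)$ put $$\Xi=\frac{r_U^l(1+\eta\sigma_1^l(U))}{1-(\sigma_2(U)/\sigma_1(U))^l},\qquad T_\kappa=\ln\Big(\frac1\kappa\Big)\ln\Big(\frac{1+\eta\sigma_1^l(U)}{1+\eta\sigma_2^l(U)}\Big)^{-1},\qquad \epsilon_\kappa=\sqrt{\frac{\kappa}{2}}\,\frac{(\sigma_1(U)r_U)^{l/2}}{4(r^2nL_s)^{l/4}}\Big(\frac\kappa4\Big)^{3\Xi/2}.$$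 **Variational eigenvalues.** $\lambda^v_k(\mathbf w)=\max_S\min_{\mathbf u\in S,\ \|\mathbf u\|_F=1}|\langle\mathbf w,\mathbf u\rangle|$, the maximum being over the subspaces $S$ spanned by $k$ pairwise orthogonal nonzero symmetric rank-one tensors $u_1^{\otimes l},\dots,u_k^{\otimes l}$; and $\tilde\lambda^v_k(\mathbf w)=\max_{V}\min_{v\in V,\ \|v\|_2=1}|\langle\mathbf w,v^{\otimes l}\rangle|$, the maximum being over the $k$-dimensional subspaces $V\subseteq\mathbb R^{nr}$ (a maximum over an empty set is $0$). **Claim.** There are universal constants $C>0$, $0<c_1\le c_2$ and $\gamma>1$, and for all $l\ge 1$ and $\Lambda>0$ a constant $a>0$ depending only on $l$ and $\Lambda$, and for all $n,r$ a number $\rho_0>0$ depending only on $l,\Lambda,n,r$, such that the following holds in the setting above whenever $L_s\le\Lambda$. There is $\theta\in[c_1,c_2]$, independent of $\kappa,\epsilon,\rho$, such that for all $\kappa\in(0,1)$, all $0<\epsilon\le a\,\epsilon_\kappa$ (in particular for $\epsilon\asymp\epsilon_\kappa$ with a sufficiently small implied constant) and all $0<\rho\le\rho_0$, with probability at least $1-2\exp(-C/\rho)$,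 simultaneously for all integers $t$ with $\theta T_\kappa\le t\le\lceil\gamma\theta T_\kappa\rceil$ (that is, for $t\asymp T_\kappa$), $$\lambda^v_1(\mathbf w_t)>0,\quad\frac{\lambda^v_2(\mathbf w_t)}{\lambda^v_1(\mathbf w_t)}\le\kappa\qquad\text{and}\qquad\tilde\lambda^v_1(\mathbf w_t)>0,\quad\frac{\tilde\lambda^v_2(\mathbf w_t)}{\tilde\lambda^v_1(\mathbf w_t)}\le\kappa .$$ -/

import Mathlib

open MeasureTheory ProbabilityTheory
open scoped NNReal ENNReal Matrix Kronecker Gradient RealInnerProductSpace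

namespace LiftedSensing

noncomputable section

/-- Cubic tensors of order `l` whose modes are indexed by `ι`, with the Frobenius inner product
and norm. -/
abbrev Tensor (l : ℕ) (ι : Type) [Fintype ι] : Type := EuclideanSpace ℝ (Fin l → ι)

/-- The symmetric rank-one tensor `x ⊗ ⋯ ⊗ x` (`l` factors). -/
def rankOne (l : ℕ) {ι : Type} [Fintype ι] (x : EuclideanSpace ℝ ι) : Tensor l ι :=
  WithLp.toLp 2 fun i => ∏ p, x (i p)

/-- The `k`-th variational eigenvalue: the largest value, over the `k`-tuples of pairwise
orthogonal nonzero symmetric rank-one tensors, of the minimum of `|⟨w, T⟩| / ‖T‖` over the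
nonzero `T` in their span `S` (normalized to `‖T‖ = 1`). -/
def vEig {l : ℕ} {ι : Type} [Fintype ι] (k : ℕ) (w : Tensor l ι) : ℝ :=
  sSup {c | ∃ u : Fin k → EuclideanSpace ℝ ι,
    (∀ i, u i ≠ 0) ∧
    (∀ i j, i ≠ j → ⟪rankOne l (u i), rankOne l (u j)⟫ = 0) ∧
    c = sInf {y | ∃ T ∈ Submodule.span ℝ (Set.range fun i => rankOne l (u i)),
      ‖T‖ = 1 ∧ y = |⟪w, T⟫|}}

/-- The `k`-th variational eigenvalue, with the inner minimum over the unit rank-one tensors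
`v ⊗ ⋯ ⊗ v`, `v ∈ V`, and the outer maximum over the `k`-dimensional subspaces `V` of the
underlying Euclidean space (for symmetric positive semidefinite matrices, `l = 2`, this is
the Courant-Fischer formula). -/
def vEigRankOne {l : ℕ} {ι : Type} [Fintype ι] (k : ℕ) (w : Tensor l ι) : ℝ :=
  sSup {c | ∃ V : Submodule ℝ (EuclideanSpace ℝ ι),
    Module.finrank ℝ V = k ∧
    c = sInf {y | ∃ v ∈ V, ‖v‖ = 1 ∧ y = |⟪w, rankOne l v⟫|}}

/-- The sensing operator `M ↦ (⟨A₁, M⟩, …, ⟨A_m, M⟩)`. -/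
def sense {n m : ℕ} (A : Fin m → Matrix (Fin n) (Fin n) ℝ) (M : Matrix (Fin n) (Fin n) ℝ)
    (k : Fin m) : ℝ :=
  ∑ i, ∑ j, A k i j * M i j

/-- The measurements `b = 𝒜(M*)` of the ground truth `M* = Z Zᵀ`. -/
def meas {n m r : ℕ} (A : Fin m → Matrix (Fin n) (Fin n) ℝ) (Z : Matrix (Fin n) (Fin r) ℝ) :
    Fin m → ℝ :=
  sense A (Z * Zᵀ)

/-- The unlifted objective `f(M) = ‖𝒜(M) - b‖² / 2`. -/
def fObj {n m r : ℕ} (A : Fin m → Matrix (Fin n) (Fin n) ℝ) (Z : Matrix (Fin n) (Fin r) ℝ)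
    (M : Matrix (Fin n) (Fin n) ℝ) : ℝ :=
  (1 / 2) * ∑ k, (sense A M k - meas A Z k) ^ 2

/-- Its gradient `∇f(M) = ∑ₖ (⟨Aₖ, M⟩ - bₖ) Aₖ`. -/
def fGrad {n m r : ℕ} (A : Fin m → Matrix (Fin n) (Fin n) ℝ) (Z : Matrix (Fin n) (Fin r) ℝ)
    (M : Matrix (Fin n) (Fin n) ℝ) : Matrix (Fin n) (Fin n) ℝ :=
  ∑ k, (sense A M k - meas A Z k) • A k

/-- Restricted strong smoothness: the `(L, r)`-RSS property, where `r` is the number of columns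
of the ground truth factor `Z`. -/
def RSS {n m r : ℕ} (A : Fin m → Matrix (Fin n) (Fin n) ℝ) (Z : Matrix (Fin n) (Fin r) ℝ)
    (L : ℝ) : Prop :=
  ∀ M N : Matrix (Fin n) (Fin n) ℝ, M.rank ≤ r → N.rank ≤ r →
    fObj A Z M - fObj A Z N ≤
      (∑ i, ∑ j, (M - N) i j * fGrad A Z N i j) + L / 2 * ∑ i, ∑ j, (M - N) i j ^ 2

/-- The lifted objective `hˡ(w) = ‖⟨A^{⊗l}, ⟨P(w), P(w)⟩⟩ - b^{⊗l}‖_F²`. The index set of the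
vectorization of an `n × r` matrix is `Fin n × Fin r`, so that the unstacked tensor `P(w)` has
the entry `w (p ↦ (i p, s p))` at the row indices `i` and the column indices `s`;
`⟨P(w), P(w)⟩` contracts all column indices. -/
def hObj (l : ℕ) {n m r : ℕ} (A : Fin m → Matrix (Fin n) (Fin n) ℝ)
    (Z : Matrix (Fin n) (Fin r) ℝ) (w : Tensor l (Fin n × Fin r)) : ℝ :=
  ∑ k : Fin l → Fin m,
    ((∑ i : Fin l → Fin n, ∑ j : Fin l → Fin n,
        (∏ p, A (k p) (i p) (j p)) *
          ∑ s : Fin l → Fin r, w (fun p => (i p, s p)) * w (fun p => (j p, s p)))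
      - ∏ p, meas A Z (k p)) ^ 2

/-- The gradient descent trajectory `w_{t+1} = w_t - η ∇hˡ(w_t)`, `w_0 = ε x₀^{⊗l}`. -/
def gd (l : ℕ) {n m r : ℕ} (A : Fin m → Matrix (Fin n) (Fin n) ℝ)
    (Z : Matrix (Fin n) (Fin r) ℝ) (η ε : ℝ) (x₀ : EuclideanSpace ℝ (Fin n × Fin r)) :
    ℕ → Tensor l (Fin n × Fin r)
  | 0 => ε • rankOne l x₀
  | t + 1 => gd l A Z η ε x₀ t - η • ∇ (hObj l A Z) (gd l A Z η ε x₀ t)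

/-- The `nr × nr` matrix `U = ⟨A_r, b⟩₃`, the Kronecker product of `∑ₖ bₖ Aₖ` and `I_r`. -/
def matU {n m r : ℕ} (A : Fin m → Matrix (Fin n) (Fin n) ℝ) (Z : Matrix (Fin n) (Fin r) ℝ) :
    Matrix (Fin n × Fin r) (Fin n × Fin r) ℝ :=
  (∑ k, meas A Z k • A k) ⊗ₖ (1 : Matrix (Fin r) (Fin r) ℝ)

/-- The largest singular value of `U`. -/
def sigma1 {n m r : ℕ} (A : Fin m → Matrix (Fin n) (Fin n) ℝ) (Z : Matrix (Fin n) (Fin r) ℝ) :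
    ℝ :=
  (Matrix.toEuclideanLin (matU A Z)).singularValues 0

/-- The second singular value of `U`. Every singular value of `∑ₖ bₖ Aₖ` occurs `r` times in `U`
because of the Kronecker factor `I_r`, and this repetition is not counted; for `r = 1` it is
literally the second singular value of `U` (the list of singular values starts at index `0`). -/
def sigma2 {n m r : ℕ} (A : Fin m → Matrix (Fin n) (Fin n) ℝ) (Z : Matrix (Fin n) (Fin r) ℝ) :
    ℝ :=
  (Matrix.toEuclideanLin (matU A Z)).singularValues r

/-- `v` is a unit singular vector of `U` for its largest singular value. -/
def IsTopSingularVector {n m r : ℕ} (A : Fin m → Matrix (Fin n) (Fin n) ℝ)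
    (Z : Matrix (Fin n) (Fin r) ℝ) (v : EuclideanSpace ℝ (Fin n × Fin r)) : Prop :=
  ‖v‖ = 1 ∧ ((matU A Z)ᵀ * matU A Z) *ᵥ v.ofLp = sigma1 A Z ^ 2 • v.ofLp

/-- `Ξ = r_Uˡ (1 + η σ₁ˡ) / (1 - (σ₂ / σ₁)ˡ)`, `r_U = rank U`. -/
def Xi (l : ℕ) {n m r : ℕ} (A : Fin m → Matrix (Fin n) (Fin n) ℝ)
    (Z : Matrix (Fin n) (Fin r) ℝ) (η : ℝ) : ℝ :=
  ((matU A Z).rank : ℝ) ^ l * (1 + η * sigma1 A Z ^ l) / (1 - (sigma2 A Z / sigma1 A Z) ^ l)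

/-- The reference time `ln(1/κ) / ln((1 + η σ₁ˡ) / (1 + η σ₂ˡ))`. -/
def timeScale (l : ℕ) {n m r : ℕ} (A : Fin m → Matrix (Fin n) (Fin n) ℝ)
    (Z : Matrix (Fin n) (Fin r) ℝ) (η κ : ℝ) : ℝ :=
  Real.log (1 / κ) / Real.log ((1 + η * sigma1 A Z ^ l) / (1 + η * sigma2 A Z ^ l))

/-- The reference initialization scale
`√(κ/2) (σ₁ r_U)^{l/2} / (4 (r² n L)^{l/4}) (κ/4)^{3Ξ/2}`. -/
def epsScale (l : ℕ) {n m r : ℕ} (A : Fin m → Matrix (Fin n) (Fin n) ℝ)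
    (Z : Matrix (Fin n) (Fin r) ℝ) (L η κ : ℝ) : ℝ :=
  Real.sqrt (κ / 2) * ((sigma1 A Z * ((matU A Z).rank : ℝ)) ^ ((l : ℝ) / 2) /
    (4 * ((r : ℝ) ^ 2 * n * L) ^ ((l : ℝ) / 4))) * (κ / 4) ^ (3 * Xi l A Z η / 2)

/-- The law `N(0, ρ I)` on the Euclidean space with coordinates in `ι`. -/
def isoGaussian (ι : Type) [Fintype ι] (ρ : ℝ≥0) : Measure (EuclideanSpace ℝ ι) :=
  (Measure.pi fun _ : ι => gaussianReal 0 ρ).map (WithLp.toLp 2)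

end

end LiftedSensing

namespace LiftedSensing

noncomputable section

section TensorAlgebra

variable {l : ℕ} {ι : Type} [Fintype ι]

/-- The rank-one tensor `x₁ ⊗ ⋯ ⊗ x_l`. -/
def prodTensor (x : Fin l → EuclideanSpace ℝ ι) : Tensor l ι :=
  WithLp.toLp 2 fun i => ∏ p, x p (i p)

@[simp] lemma prodTensor_apply (x : Fin l → EuclideanSpace ℝ ι) (i : Fin l → ι) :
    prodTensor x i = ∏ p, x p (i p) := rfl

@[simp] lemma rankOne_apply (x : EuclideanSpace ℝ ι) (i : Fin l → ι) :
    rankOne l x i = ∏ p, x (i p) := rfl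

lemma rankOne_eq_prodTensor (x : EuclideanSpace ℝ ι) :
    rankOne l x = prodTensor fun _ => x := rfl

/-- The Kronecker product of a family of square matrices. -/
def kron (M : Fin l → Matrix ι ι ℝ) : Matrix (Fin l → ι) (Fin l → ι) ℝ :=
  Matrix.of fun i j => ∏ p, M p (i p) (j p)

lemma sum_pi_eq_prod_sum {κ : Type} [Fintype κ] (f : Fin l → κ → ℝ) :
    ∑ k : Fin l → κ, ∏ p, f p (k p) = ∏ p, ∑ j, f p j := by
  rw [Finset.prod_univ_sum, Fintype.piFinset_univ]

lemma inner_eq_sum {κ : Type} [Fintype κ] (x y : EuclideanSpace ℝ κ) :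
    ⟪x, y⟫ = ∑ i, x i * y i := by
  simp [PiLp.inner_apply, mul_comm]

lemma inner_prodTensor (x y : Fin l → EuclideanSpace ℝ ι) :
    ⟪prodTensor x, prodTensor y⟫ = ∏ p, ⟪x p, y p⟫ := by
  simp only [inner_eq_sum, prodTensor_apply, ← Finset.prod_mul_distrib]
  exact sum_pi_eq_prod_sum fun p j => x p j * y p j

lemma inner_rankOne (x y : EuclideanSpace ℝ ι) :
    ⟪rankOne l x, rankOne l y⟫ = ⟪x, y⟫ ^ l := by
  simp [rankOne_eq_prodTensor, inner_prodTensor]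

lemma norm_rankOne (x : EuclideanSpace ℝ ι) : ‖rankOne l x‖ = ‖x‖ ^ l := by
  have h : ‖rankOne l x‖ ^ 2 = (‖x‖ ^ l) ^ 2 := by
    rw [← real_inner_self_eq_norm_sq, inner_rankOne, real_inner_self_eq_norm_sq]; ring
  exact (pow_left_inj₀ (norm_nonneg _) (by positivity) two_ne_zero).1 h

lemma rankOne_smul (c : ℝ) (x : EuclideanSpace ℝ ι) :
    rankOne l (c • x) = c ^ l • rankOne l x := by
  ext i; simp [Finset.prod_mul_distrib]

lemma toEuclideanLin_apply_apply {κ : Type} [Fintype κ] [DecidableEq κ] (M : Matrix κ κ ℝ)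
    (x : EuclideanSpace ℝ κ) (i : κ) : Matrix.toEuclideanLin M x i = ∑ j, M i j * x j := by
  simp [Matrix.toLpLin_apply, Matrix.mulVec, dotProduct]

lemma inner_toEuclideanLin {κ : Type} [Fintype κ] [DecidableEq κ] {M : Matrix κ κ ℝ}
    (hM : M.IsSymm) (x y : EuclideanSpace ℝ κ) :
    ⟪Matrix.toEuclideanLin M x, y⟫ = ⟪x, Matrix.toEuclideanLin M y⟫ := by
  simp only [inner_eq_sum, toEuclideanLin_apply_apply, Finset.sum_mul, Finset.mul_sum]
  rw [Finset.sum_comm]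
  refine Finset.sum_congr rfl fun i _ => Finset.sum_congr rfl fun j _ => ?_
  rw [hM.apply i j]; ring

lemma kron_isSymm {l : ℕ} {ι : Type} {M : Fin l → Matrix ι ι ℝ} (hM : ∀ p, (M p).IsSymm) :
    (kron M).IsSymm := by
  ext i j
  simp only [Matrix.transpose_apply, kron, Matrix.of_apply]
  exact Finset.prod_congr rfl fun p _ => (hM p).apply _ _

lemma sum_smul_prodTensor {κ : Type} [Fintype κ] (c : κ → ℝ) (X : κ → EuclideanSpace ℝ ι) :
    ∑ k : Fin l → κ, (∏ p, c (k p)) • prodTensor (fun p => X (k p)) =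
      rankOne l (∑ j, c j • X j) := by
  ext i
  simp only [WithLp.ofLp_sum, WithLp.ofLp_smul, Finset.sum_apply, Pi.smul_apply, smul_eq_mul,
    prodTensor_apply, rankOne_apply, ← Finset.prod_mul_distrib]
  exact sum_pi_eq_prod_sum fun p j => c j * X j (i p)

lemma sum_smul_kron {l : ℕ} {ι : Type} {κ : Type} [Fintype κ] (c : κ → ℝ) (M : κ → Matrix ι ι ℝ) :
    ∑ k : Fin l → κ, (∏ p, c (k p)) • kron (fun p => M (k p)) =
      kron fun _ => ∑ j, c j • M j := by
  ext i j
  simp only [Matrix.sum_apply, Matrix.smul_apply, kron, Matrix.of_apply, smul_eq_mul,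
    ← Finset.prod_mul_distrib]
  exact sum_pi_eq_prod_sum fun p k => c k * M k (i p) (j p)

variable [DecidableEq ι]

lemma kron_prodTensor (M : Fin l → Matrix ι ι ℝ) (x : Fin l → EuclideanSpace ℝ ι) :
    Matrix.toEuclideanLin (kron M) (prodTensor x) =
      prodTensor fun p => Matrix.toEuclideanLin (M p) (x p) := by
  ext i
  simp only [toEuclideanLin_apply_apply, prodTensor_apply, kron, Matrix.of_apply,
    ← Finset.prod_mul_distrib]
  exact sum_pi_eq_prod_sum fun p j => M p (i p) j * x p j

lemma kron_const_rankOne (M : Matrix ι ι ℝ) (x : EuclideanSpace ℝ ι) :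
    Matrix.toEuclideanLin (kron fun _ : Fin l => M) (rankOne l x) =
      rankOne l (Matrix.toEuclideanLin M x) := by
  simp [rankOne_eq_prodTensor, kron_prodTensor]

end TensorAlgebra

section Gradient

variable {n m r : ℕ}

/-- The action `M ↦ Aₖ M` of a sensing matrix on vectorized `n × r` matrices. -/
def ampMat (A : Fin m → Matrix (Fin n) (Fin n) ℝ) (r : ℕ) (k : Fin m) :
    Matrix (Fin n × Fin r) (Fin n × Fin r) ℝ :=
  A k ⊗ₖ (1 : Matrix (Fin r) (Fin r) ℝ)

lemma ampMat_isSymm {A : Fin m → Matrix (Fin n) (Fin n) ℝ} (hA : ∀ k, (A k).IsSymm) (k : Fin m) :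
    (ampMat A r k).IsSymm := by
  ext ⟨i, s⟩ ⟨j, s'⟩
  simp only [ampMat, Matrix.transpose_apply, Matrix.kroneckerMap_apply, (hA k).apply i j,
    Matrix.one_apply, eq_comm]

lemma matU_eq_sum (A : Fin m → Matrix (Fin n) (Fin n) ℝ) (Z : Matrix (Fin n) (Fin r) ℝ) :
    matU A Z = ∑ k, meas A Z k • ampMat A r k := by
  ext ⟨i, s⟩ ⟨j, s'⟩
  simp [matU, ampMat, Matrix.sum_apply, Finset.sum_mul, mul_assoc]

lemma matU_isSymm {A : Fin m → Matrix (Fin n) (Fin n) ℝ} (hA : ∀ k, (A k).IsSymm)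
    (Z : Matrix (Fin n) (Fin r) ℝ) : (matU A Z).IsSymm := by
  rw [matU_eq_sum]
  ext i j
  simp only [Matrix.transpose_apply, Matrix.sum_apply, Matrix.smul_apply,
    (ampMat_isSymm hA _).apply i j]

variable {l : ℕ}

/-- The lifted sensing matrices, acting on tensors. -/
def liftOp (A : Fin m → Matrix (Fin n) (Fin n) ℝ) (k : Fin l → Fin m) :
    Tensor l (Fin n × Fin r) →ₗ[ℝ] Tensor l (Fin n × Fin r) :=
  Matrix.toEuclideanLin (kron fun p => ampMat A r (k p))

lemma inner_liftOp {A : Fin m → Matrix (Fin n) (Fin n) ℝ} (hA : ∀ k, (A k).IsSymm)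
    (k : Fin l → Fin m) (x y : Tensor l (Fin n × Fin r)) :
    ⟪liftOp A k x, y⟫ = ⟪x, liftOp A k y⟫ :=
  inner_toEuclideanLin (kron_isSymm fun p => ampMat_isSymm hA (k p)) x y

/-- The lifted measurement operator `U ⊗ ⋯ ⊗ U`. -/
def liftU (l : ℕ) (A : Fin m → Matrix (Fin n) (Fin n) ℝ) (Z : Matrix (Fin n) (Fin r) ℝ) :
    Tensor l (Fin n × Fin r) →ₗ[ℝ] Tensor l (Fin n × Fin r) :=
  Matrix.toEuclideanLin (kron fun _ => matU A Z)

lemma sum_smul_liftOp (A : Fin m → Matrix (Fin n) (Fin n) ℝ) (Z : Matrix (Fin n) (Fin r) ℝ)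
    (w : Tensor l (Fin n × Fin r)) :
    ∑ k : Fin l → Fin m, (∏ p, meas A Z (k p)) • liftOp A k w = liftU l A Z w := by
  simp only [liftOp, liftU, matU_eq_sum, ← sum_smul_kron, map_sum, map_smul, LinearMap.sum_apply,
    LinearMap.smul_apply]

/-- The trilinear map whose diagonal is the cubic part of the gradient of the lifted objective. -/
def cubic (A : Fin m → Matrix (Fin n) (Fin n) ℝ) (x y z : Tensor l (Fin n × Fin r)) :
    Tensor l (Fin n × Fin r) :=
  ∑ k : Fin l → Fin m, ⟪x, liftOp A k y⟫ • liftOp A k z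

lemma hObj_eq (A : Fin m → Matrix (Fin n) (Fin n) ℝ) (Z : Matrix (Fin n) (Fin r) ℝ)
    (w : Tensor l (Fin n × Fin r)) :
    hObj l A Z w =
      ∑ k : Fin l → Fin m, (⟪w, liftOp A k w⟫ - ∏ p, meas A Z (k p)) ^ 2 := by
  refine Finset.sum_congr rfl fun k _ => ?_
  congr 2
  simp only [inner_eq_sum, liftOp, toEuclideanLin_apply_apply, Finset.mul_sum]
  let e := Equiv.arrowProdEquivProdArrow (Fin l) (fun _ => Fin n) (fun _ => Fin r)
  rw [← e.symm.sum_comp, Fintype.sum_prod_type]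
  refine Finset.sum_congr rfl fun i _ => ?_
  rw [Finset.sum_comm]
  refine Finset.sum_congr rfl fun s _ => ?_
  rw [← e.symm.sum_comp, Fintype.sum_prod_type]
  refine Finset.sum_congr rfl fun j _ => ?_
  rw [Finset.sum_eq_single s]
  · simp [e, Equiv.arrowProdEquivProdArrow, kron, ampMat]; ring
  · intro s' _ hs
    obtain ⟨p, hp⟩ := Function.ne_iff.1 hs
    have : ∏ p, ampMat A r (k p) (i p, s p) (j p, s' p) = 0 :=
      Finset.prod_eq_zero (Finset.mem_univ p) (by simp [ampMat, Ne.symm hp])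
    simp [e, Equiv.arrowProdEquivProdArrow, kron, this]
  · simp

lemma hasFDerivAt_sq_inner_sub {E : Type} [NormedAddCommGroup E] [InnerProductSpace ℝ E]
    [FiniteDimensional ℝ E] {T : E →ₗ[ℝ] E} (hT : ∀ x y, ⟪T x, y⟫ = ⟪x, T y⟫) (c : ℝ) (w : E) :
    HasFDerivAt (fun w : E => (⟪w, T w⟫ - c) ^ 2)
      (innerSL ℝ ((4 * (⟪w, T w⟫ - c)) • T w)) w := by
  have hT' := (LinearMap.toContinuousLinearMap T).hasFDerivAt (x := w)
  have := (((hasFDerivAt_id w).inner ℝ hT').sub_const c).pow 2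
  refine this.congr_fderiv ?_
  ext v
  have h1 : ⟪w, T v⟫ = ⟪T w, v⟫ := (hT w v).symm
  have h2 : ⟪v, T w⟫ = ⟪T w, v⟫ := real_inner_comm _ _
  simp [h1, h2]
  ring

lemma gradient_hObj {A : Fin m → Matrix (Fin n) (Fin n) ℝ} (hA : ∀ k, (A k).IsSymm)
    (Z : Matrix (Fin n) (Fin r) ℝ) (w : Tensor l (Fin n × Fin r)) :
    ∇ (hObj l A Z) w = (4 : ℝ) • (cubic A w w w - liftU l A Z w) := by
  apply HasGradientAt.gradient
  rw [hasGradientAt_iff_hasFDerivAt, show hObj l A Z = _ from funext (hObj_eq A Z)]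
  refine (HasFDerivAt.fun_sum (u := Finset.univ) fun (k : Fin l → Fin m) _ =>
    hasFDerivAt_sq_inner_sub (inner_liftOp hA k) (∏ p, meas A Z (k p)) w).congr_fderiv ?_
  rw [← map_sum]
  change innerSL ℝ _ = innerSL ℝ _
  congr 1
  simp only [cubic, ← sum_smul_liftOp A Z, ← Finset.sum_sub_distrib, Finset.smul_sum,
    smul_smul, ← sub_smul, mul_sub]

lemma gd_succ {A : Fin m → Matrix (Fin n) (Fin n) ℝ} (hA : ∀ k, (A k).IsSymm)
    (Z : Matrix (Fin n) (Fin r) ℝ) (η ε : ℝ) (x₀ : EuclideanSpace ℝ (Fin n × Fin r)) (t : ℕ) :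
    gd l A Z η ε x₀ (t + 1) =
      gd l A Z η ε x₀ t + (4 * η) • liftU l A Z (gd l A Z η ε x₀ t) -
        (4 * η) • cubic A (gd l A Z η ε x₀ t) (gd l A Z η ε x₀ t) (gd l A Z η ε x₀ t) := by
  rw [gd, gradient_hObj hA, smul_smul, smul_sub, mul_comm η]
  abel

lemma cubic_rankOne (A : Fin m → Matrix (Fin n) (Fin n) ℝ)
    (x y z : EuclideanSpace ℝ (Fin n × Fin r)) :
    cubic A (rankOne l x) (rankOne l y) (rankOne l z) =
      rankOne l (∑ k, ⟪x, Matrix.toEuclideanLin (ampMat A r k) y⟫ •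
        Matrix.toEuclideanLin (ampMat A r k) z) := by
  simp only [cubic, liftOp, rankOne_eq_prodTensor, kron_prodTensor, inner_prodTensor]
  exact sum_smul_prodTensor (fun k => ⟪x, Matrix.toEuclideanLin (ampMat A r k) y⟫)
    fun k => Matrix.toEuclideanLin (ampMat A r k) z

lemma liftU_rankOne (A : Fin m → Matrix (Fin n) (Fin n) ℝ) (Z : Matrix (Fin n) (Fin r) ℝ)
    (x : EuclideanSpace ℝ (Fin n × Fin r)) :
    liftU l A Z (rankOne l x) = rankOne l (Matrix.toEuclideanLin (matU A Z) x) :=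
  kron_const_rankOne _ _

end Gradient

section AtomicNorm

variable {l : ℕ} {ι : Type} [Fintype ι]

/-- The projective norm of `w` with respect to symmetric rank-one tensors is at most `C`, witnessed
by a finite decomposition. -/
def AtomBd (C : ℝ) (w : Tensor l ι) : Prop :=
  ∃ (J : Type) (_ : Fintype J) (c : J → ℝ) (x : J → EuclideanSpace ℝ ι),
    (∀ j, ‖x j‖ ≤ 1) ∧ w = ∑ j, c j • rankOne l (x j) ∧ ∑ j, |c j| ≤ C

namespace AtomBd

lemma mono {C D : ℝ} {w : Tensor l ι} (h : AtomBd C w) (hCD : C ≤ D) : AtomBd D w := by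
  obtain ⟨J, hJ, c, x, hx, hw, hc⟩ := h
  exact ⟨J, hJ, c, x, hx, hw, hc.trans hCD⟩

lemma zero : AtomBd 0 (0 : Tensor l ι) :=
  ⟨Empty, inferInstance, fun _ => 0, fun _ => 0, by simp, by simp, by simp⟩

lemma add {C D : ℝ} {v w : Tensor l ι} (hv : AtomBd C v) (hw : AtomBd D w) :
    AtomBd (C + D) (v + w) := by
  obtain ⟨J, _, c, x, hx, rfl, hc⟩ := hv
  obtain ⟨K, _, d, y, hy, rfl, hd⟩ := hw
  refine ⟨J ⊕ K, inferInstance, Sum.elim c d, Sum.elim x y, ?_, by simp, ?_⟩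
  · rintro (j | k) <;> simp [hx, hy]
  · simpa using add_le_add hc hd

lemma smul {C : ℝ} {w : Tensor l ι} (h : AtomBd C w) (a : ℝ) : AtomBd (|a| * C) (a • w) := by
  obtain ⟨J, _, c, x, hx, rfl, hc⟩ := h
  refine ⟨J, inferInstance, fun j => a * c j, x, hx, by simp [Finset.smul_sum, smul_smul], ?_⟩
  simp only [abs_mul, ← Finset.mul_sum]
  gcongr

lemma sub {C D : ℝ} {v w : Tensor l ι} (hv : AtomBd C v) (hw : AtomBd D w) :
    AtomBd (C + D) (v - w) := by
  have := hv.add (hw.smul (-1))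
  simpa [sub_eq_add_neg] using this

lemma sum {J : Type} (s : Finset J) {C : J → ℝ} {w : J → Tensor l ι}
    (h : ∀ j, AtomBd (C j) (w j)) : AtomBd (∑ j ∈ s, C j) (∑ j ∈ s, w j) := by
  classical
  induction s using Finset.induction_on with
  | empty => simpa using AtomBd.zero
  | insert j s hj ih => simpa [Finset.sum_insert hj] using (h j).add ih

lemma rankOne (x : EuclideanSpace ℝ ι) : AtomBd (‖x‖ ^ l) (rankOne l x) := by
  refine ⟨Unit, inferInstance, fun _ => ‖x‖ ^ l, fun _ => ‖x‖⁻¹ • x, fun _ => ?_, ?_, ?_⟩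
  · rw [norm_smul, norm_inv, norm_norm]
    exact inv_mul_le_one
  · rcases eq_or_ne x 0 with rfl | hx
    · rcases Nat.eq_zero_or_pos l with rfl | hl
      · simp
      · ext i; simp [hl.ne']
    · simp only [Finset.univ_unique, Finset.sum_singleton, ← rankOne_smul, smul_smul]
      rw [mul_inv_cancel₀ (norm_ne_zero_iff.2 hx), one_smul]
  · simp

lemma of_eq_sum {J : Type} [Fintype J] {c : J → ℝ} {x : J → EuclideanSpace ℝ ι} {K C : ℝ}
    (hK : 0 ≤ K) (hx : ∀ j, ‖x j‖ ≤ K) (hc : ∑ j, |c j| ≤ C) :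
    AtomBd (K ^ l * C) (∑ j, c j • LiftedSensing.rankOne l (x j)) := by
  refine (AtomBd.sum Finset.univ fun j => (AtomBd.rankOne (l := l) (x j)).smul (c j)).mono ?_
  calc ∑ j, |c j| * ‖x j‖ ^ l ≤ ∑ j, |c j| * K ^ l := by
        gcongr with j _
        exact hx j
    _ = K ^ l * ∑ j, |c j| := by rw [← Finset.sum_mul, mul_comm]
    _ ≤ K ^ l * C := by gcongr

lemma abs_inner_le {C : ℝ} {w : Tensor l ι} (h : AtomBd C w) (v : EuclideanSpace ℝ ι) :
    |⟪w, LiftedSensing.rankOne l v⟫| ≤ C * ‖v‖ ^ l := by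
  obtain ⟨J, _, c, x, hx, rfl, hc⟩ := h
  simp only [sum_inner, real_inner_smul_left, inner_rankOne]
  calc |∑ j, c j * ⟪x j, v⟫ ^ l| ≤ ∑ j, |c j * ⟪x j, v⟫ ^ l| := Finset.abs_sum_le_sum_abs _ _
    _ ≤ ∑ j, |c j| * ‖v‖ ^ l := by
        gcongr with j _
        rw [abs_mul, abs_pow]
        gcongr
        exact (abs_real_inner_le_norm _ _).trans (mul_le_of_le_one_left (norm_nonneg _) (hx j))
    _ = (∑ j, |c j|) * ‖v‖ ^ l := by rw [Finset.sum_mul]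
    _ ≤ C * ‖v‖ ^ l := by gcongr

lemma map_le {C K : ℝ} {w : Tensor l ι} (h : AtomBd C w) (hK : 0 ≤ K)
    {T : Tensor l ι →ₗ[ℝ] Tensor l ι} {f : EuclideanSpace ℝ ι → EuclideanSpace ℝ ι}
    (hT : ∀ x, T (LiftedSensing.rankOne l x) = LiftedSensing.rankOne l (f x))
    (hf : ∀ x, ‖f x‖ ≤ K * ‖x‖) : AtomBd (K ^ l * C) (T w) := by
  obtain ⟨J, _, c, x, hx, rfl, hc⟩ := h
  simp only [map_sum, map_smul, hT]
  exact of_eq_sum hK (fun j => (hf _).trans (mul_le_of_le_one_right hK (hx j))) hc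

end AtomBd

end AtomicNorm

section Smoothness

variable {l n m r : ℕ} {A : Fin m → Matrix (Fin n) (Fin n) ℝ} {Z : Matrix (Fin n) (Fin r) ℝ}
  {L : ℝ}

lemma RSS.sum_sq_sense_le (h : RSS A Z L) {M : Matrix (Fin n) (Fin n) ℝ} (hM : M.rank ≤ r) :
    ∑ k, sense A M k ^ 2 ≤ L * ∑ i, ∑ j, M i j ^ 2 := by
  have h0 := h M 0 hM (by simp)
  have hs : ∀ k, sense A 0 k = 0 := fun k => by simp [sense]
  have hg : ∑ i, ∑ j, (M - 0) i j * fGrad A Z 0 i j = -∑ k, meas A Z k * sense A M k := by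
    have h1 : ∀ i j, (M - 0) i j * fGrad A Z 0 i j =
        ∑ k, -(meas A Z k * (A k i j * M i j)) := by
      intro i j
      simp only [fGrad, hs, Matrix.sum_apply, Matrix.smul_apply, smul_eq_mul, Finset.mul_sum,
        sub_zero]
      exact Finset.sum_congr rfl fun k _ => by ring
    simp only [h1, sense, Finset.mul_sum, ← Finset.sum_neg_distrib]
    rw [Finset.sum_congr rfl fun i _ => Finset.sum_comm, Finset.sum_comm]
  rw [hg] at h0
  simp only [fObj, hs, sub_zero, zero_sub, sub_sq, neg_sq, Finset.sum_add_distrib,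
    Finset.sum_sub_distrib] at h0
  have h2 : ∑ k, 2 * sense A M k * meas A Z k = 2 * ∑ k, meas A Z k * sense A M k := by
    rw [Finset.mul_sum]
    exact Finset.sum_congr rfl fun k _ => by ring
  rw [h2] at h0
  linarith

/-- The `n × r` matrix with a given vectorization. -/
def unvec (x : EuclideanSpace ℝ (Fin n × Fin r)) : Matrix (Fin n) (Fin r) ℝ :=
  Matrix.of fun i s => x (i, s)

lemma inner_ampMat (A : Fin m → Matrix (Fin n) (Fin n) ℝ) (k : Fin m)
    (x y : EuclideanSpace ℝ (Fin n × Fin r)) :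
    ⟪x, Matrix.toEuclideanLin (ampMat A r k) y⟫ = sense A (unvec x * (unvec y)ᵀ) k := by
  simp only [inner_eq_sum, toEuclideanLin_apply_apply, sense, Matrix.mul_apply, unvec,
    Matrix.transpose_apply, Matrix.of_apply, Fintype.sum_prod_type, Finset.mul_sum, ampMat,
    Matrix.kroneckerMap_apply, Matrix.one_apply]
  refine Finset.sum_congr rfl fun i _ => ?_
  rw [Finset.sum_comm]
  refine Finset.sum_congr rfl fun j _ => Finset.sum_congr rfl fun s _ => ?_
  simp
  ring

lemma sum_sq_unvec_mul_le (x y : EuclideanSpace ℝ (Fin n × Fin r)) :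
    ∑ i, ∑ j, (unvec x * (unvec y)ᵀ) i j ^ 2 ≤ ‖x‖ ^ 2 * ‖y‖ ^ 2 := by
  have hn : ∀ z : EuclideanSpace ℝ (Fin n × Fin r), ‖z‖ ^ 2 = ∑ i, ∑ s, z (i, s) ^ 2 := by
    intro z
    rw [EuclideanSpace.real_norm_sq_eq, Fintype.sum_prod_type]
  rw [hn, hn, Finset.sum_mul_sum]
  gcongr with i _ j _
  simpa only [Matrix.mul_apply, unvec, Matrix.transpose_apply, Matrix.of_apply] using
    Finset.sum_mul_sq_le_sq_mul_sq Finset.univ (fun s => x (i, s)) (fun s => y (j, s))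

lemma RSS.sum_sq_inner_le (h : RSS A Z L) (hL : 0 ≤ L)
    (x y : EuclideanSpace ℝ (Fin n × Fin r)) :
    ∑ k, ⟪x, Matrix.toEuclideanLin (ampMat A r k) y⟫ ^ 2 ≤ L * (‖x‖ ^ 2 * ‖y‖ ^ 2) := by
  simp only [inner_ampMat]
  refine (h.sum_sq_sense_le ?_).trans (by gcongr; exact sum_sq_unvec_mul_le x y)
  exact (Matrix.rank_mul_le_left _ _).trans (Matrix.rank_le_width _)

lemma RSS.norm_sum_le (h : RSS A Z L) (hL : 0 ≤ L)
    (x y z : EuclideanSpace ℝ (Fin n × Fin r)) :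
    ‖∑ k, ⟪x, Matrix.toEuclideanLin (ampMat A r k) y⟫ •
      Matrix.toEuclideanLin (ampMat A r k) z‖ ≤ L * (‖x‖ * ‖y‖ * ‖z‖) := by
  set c := ∑ k, ⟪x, Matrix.toEuclideanLin (ampMat A r k) y⟫ •
      Matrix.toEuclideanLin (ampMat A r k) z with hc
  have h1 : ‖c‖ ^ 2 = ∑ k, ⟪x, Matrix.toEuclideanLin (ampMat A r k) y⟫ *
      ⟪c, Matrix.toEuclideanLin (ampMat A r k) z⟫ := by
    rw [← real_inner_self_eq_norm_sq]
    nth_rewrite 2 [hc]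
    simp only [inner_sum, real_inner_smul_right]
  have h2 : (‖c‖ ^ 2) ^ 2 ≤ (L * (‖x‖ * ‖y‖ * ‖z‖) * ‖c‖) ^ 2 := by
    rw [h1]
    refine (Finset.sum_mul_sq_le_sq_mul_sq _ _ _).trans ?_
    refine (mul_le_mul (h.sum_sq_inner_le hL x y) (h.sum_sq_inner_le hL c z)
      (by positivity) (by positivity)).trans_eq (by ring)
  have h3 : ‖c‖ * ‖c‖ ≤ L * (‖x‖ * ‖y‖ * ‖z‖) * ‖c‖ := by
    rw [← sq]
    exact le_of_sq_le_sq h2 (by positivity)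
  rcases (norm_nonneg c).eq_or_lt with h0 | h0
  · rw [← h0]; positivity
  · exact le_of_mul_le_mul_right h3 h0

lemma cubic_sum_left {J : Type} [Fintype J] (A : Fin m → Matrix (Fin n) (Fin n) ℝ) (c : J → ℝ)
    (x : J → Tensor l (Fin n × Fin r)) (y z : Tensor l (Fin n × Fin r)) :
    cubic A (∑ j, c j • x j) y z = ∑ j, c j • cubic A (x j) y z := by
  simp only [cubic, sum_inner, real_inner_smul_left, Finset.smul_sum, Finset.sum_smul, smul_smul]
  exact Finset.sum_comm

lemma cubic_sum_mid {J : Type} [Fintype J] (A : Fin m → Matrix (Fin n) (Fin n) ℝ) (c : J → ℝ)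
    (x : J → Tensor l (Fin n × Fin r)) (y z : Tensor l (Fin n × Fin r)) :
    cubic A y (∑ j, c j • x j) z = ∑ j, c j • cubic A y (x j) z := by
  simp only [cubic, map_sum, map_smul, inner_sum, real_inner_smul_right, Finset.smul_sum,
    Finset.sum_smul, smul_smul]
  exact Finset.sum_comm

lemma cubic_sum_right {J : Type} [Fintype J] (A : Fin m → Matrix (Fin n) (Fin n) ℝ) (c : J → ℝ)
    (x : J → Tensor l (Fin n × Fin r)) (y z : Tensor l (Fin n × Fin r)) :
    cubic A y z (∑ j, c j • x j) = ∑ j, c j • cubic A y z (x j) := by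
  simp only [cubic, map_sum, map_smul, Finset.smul_sum, smul_smul]
  rw [Finset.sum_comm]
  exact Finset.sum_congr rfl fun j _ => Finset.sum_congr rfl fun k _ => by rw [mul_comm]

lemma RSS.atomBd_cubic (h : RSS A Z L) (hL : 0 ≤ L) {a b c : ℝ}
    {x y z : Tensor l (Fin n × Fin r)} (hx : AtomBd a x) (hy : AtomBd b y) (hz : AtomBd c z) :
    AtomBd (L ^ l * (a * b * c)) (cubic A x y z) := by
  obtain ⟨I, _, p, u, hu, rfl, hp⟩ := hx
  obtain ⟨J, _, q, v, hv, rfl, hq⟩ := hy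
  obtain ⟨K, _, s, w, hw, rfl, hs⟩ := hz
  have key : cubic A (∑ i, p i • rankOne l (u i)) (∑ j, q j • rankOne l (v j))
      (∑ k, s k • rankOne l (w k)) =
      ∑ t : I × J × K, (p t.1 * q t.2.1 * s t.2.2) •
        rankOne l (∑ k, ⟪u t.1, Matrix.toEuclideanLin (ampMat A r k) (v t.2.1)⟫ •
          Matrix.toEuclideanLin (ampMat A r k) (w t.2.2)) := by
    simp_rw [cubic_sum_left, cubic_sum_mid, cubic_sum_right]
    simp only [← cubic_rankOne, Fintype.sum_prod_type, Finset.smul_sum, smul_smul, mul_assoc]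
  rw [key]
  refine AtomBd.of_eq_sum hL (fun t => (h.norm_sum_le hL _ _ _).trans ?_) ?_
  · refine mul_le_of_le_one_right hL ?_
    exact mul_le_one₀ (mul_le_one₀ (hu _) (norm_nonneg _) (hv _)) (norm_nonneg _) (hw _)
  · have : ∑ t : I × J × K, |p t.1 * q t.2.1 * s t.2.2| =
        (∑ i, |p i|) * (∑ j, |q j|) * ∑ k, |s k| := by
      simp only [abs_mul, Fintype.sum_prod_type,
        ← Finset.mul_sum, ← Finset.sum_mul]
    rw [this]
    have h1 : 0 ≤ ∑ i, |p i| := Finset.sum_nonneg fun _ _ => abs_nonneg _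
    have h2 : 0 ≤ ∑ i, |q i| := Finset.sum_nonneg fun _ _ => abs_nonneg _
    have h3 : 0 ≤ ∑ i, |s i| := Finset.sum_nonneg fun _ _ => abs_nonneg _
    exact mul_le_mul (mul_le_mul hp hq h2 (h1.trans hp)) hs h3
      (mul_nonneg (h1.trans hp) (h2.trans hq))

end Smoothness

section Linearization

variable {l n m r : ℕ}

/-- The iterates of the linearized gradient descent started at `x ⊗ ⋯ ⊗ x`. -/
def lin (l : ℕ) (A : Fin m → Matrix (Fin n) (Fin n) ℝ) (Z : Matrix (Fin n) (Fin r) ℝ) (η : ℝ) :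
    ℕ → EuclideanSpace ℝ (Fin n × Fin r) → Tensor l (Fin n × Fin r)
  | 0, x => rankOne l x
  | t + 1, x => lin l A Z η t x + (4 * η) • lin l A Z η t (Matrix.toEuclideanLin (matU A Z) x)

variable {A : Fin m → Matrix (Fin n) (Fin n) ℝ} {Z : Matrix (Fin n) (Fin r) ℝ}

lemma liftU_lin (η : ℝ) (t : ℕ) (x : EuclideanSpace ℝ (Fin n × Fin r)) :
    liftU l A Z (lin l A Z η t x) = lin l A Z η t (Matrix.toEuclideanLin (matU A Z) x) := by
  induction t generalizing x with
  | zero => simp [lin, liftU_rankOne]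
  | succ t ih => simp [lin, ih]

lemma lin_succ (η : ℝ) (t : ℕ) (x : EuclideanSpace ℝ (Fin n × Fin r)) :
    lin l A Z η (t + 1) x = lin l A Z η t x + (4 * η) • liftU l A Z (lin l A Z η t x) := by
  rw [liftU_lin, lin]

lemma atomBd_lin {η σ : ℝ} (hη : 0 ≤ η) (hσ : 0 ≤ σ)
    (hU : ∀ x : EuclideanSpace ℝ (Fin n × Fin r),
      ‖Matrix.toEuclideanLin (matU A Z) x‖ ≤ σ * ‖x‖)
    (t : ℕ) (x : EuclideanSpace ℝ (Fin n × Fin r)) :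
    AtomBd ((1 + 4 * η * σ ^ l) ^ t * ‖x‖ ^ l) (lin l A Z η t x) := by
  induction t with
  | zero => simpa [lin] using AtomBd.rankOne (l := l) x
  | succ t ih =>
    rw [lin_succ]
    refine (ih.add ((ih.map_le hσ (liftU_rankOne A Z) hU).smul (4 * η))).mono (le_of_eq ?_)
    rw [abs_of_nonneg (by positivity)]
    ring

/-- On an eigenvector `v` of `U`, the linearized dynamics grows geometrically. -/
lemma inner_lin_eigenvector (hA : ∀ k, (A k).IsSymm) {v : EuclideanSpace ℝ (Fin n × Fin r)}
    {μ : ℝ} (hv : Matrix.toEuclideanLin (matU A Z) v = μ • v) (η : ℝ) (t : ℕ)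
    (x : EuclideanSpace ℝ (Fin n × Fin r)) :
    ⟪lin l A Z η t x, rankOne l v⟫ = (1 + 4 * η * μ ^ l) ^ t * ⟪x, v⟫ ^ l := by
  induction t generalizing x with
  | zero => simp [lin, inner_rankOne]
  | succ t ih =>
    rw [lin, inner_add_left, real_inner_smul_left, ih, ih, inner_toEuclideanLin (matU_isSymm hA Z),
      hv, real_inner_smul_right]
    ring

/-- If `x` differs from `z` by an element orthogonal to `v`, and this persists under `U`, then the
linearized dynamics of `x` in the direction `v` is bounded by the growth rate of `z`. -/
lemma abs_inner_lin_le {η σ : ℝ} (hη : 0 ≤ η) (hσ : 0 ≤ σ)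
    {v : EuclideanSpace ℝ (Fin n × Fin r)} (hv : ‖v‖ = 1)
    (P : EuclideanSpace ℝ (Fin n × Fin r) → EuclideanSpace ℝ (Fin n × Fin r) → Prop)
    (hP : ∀ x z, P x z → P (Matrix.toEuclideanLin (matU A Z) x)
      (Matrix.toEuclideanLin (matU A Z) z))
    (hPv : ∀ x z, P x z → ⟪x, v⟫ = ⟪z, v⟫)
    (hPσ : ∀ x z, P x z → ‖Matrix.toEuclideanLin (matU A Z) z‖ ≤ σ * ‖z‖)
    (t : ℕ) {x z : EuclideanSpace ℝ (Fin n × Fin r)} (h : P x z) :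
    |⟪lin l A Z η t x, rankOne l v⟫| ≤ (1 + 4 * η * σ ^ l) ^ t * ‖z‖ ^ l := by
  induction t generalizing x z with
  | zero =>
    rw [lin, inner_rankOne, hPv x z h, pow_zero, one_mul, abs_pow]
    gcongr
    simpa [hv] using abs_real_inner_le_norm z v
  | succ t ih =>
    rw [lin, inner_add_left, real_inner_smul_left]
    refine (abs_add_le _ _).trans ?_
    rw [abs_mul, abs_of_nonneg (by positivity : 0 ≤ 4 * η)]
    have h1 := ih h
    have h2 := (ih (hP x z h)).trans (mul_le_mul_of_nonneg_left
      (pow_le_pow_left₀ (norm_nonneg _) (hPσ x z h) l) (by positivity))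
    calc _ ≤ (1 + 4 * η * σ ^ l) ^ t * ‖z‖ ^ l +
        4 * η * ((1 + 4 * η * σ ^ l) ^ t * (σ * ‖z‖) ^ l) := by gcongr
      _ = _ := by ring

/-- As long as the iterates are small, gradient descent follows the linearized dynamics. -/
lemma atomBd_gd_sub_lin {L η ε σ : ℝ} (hA : ∀ k, (A k).IsSymm) (hR : RSS A Z L) (hL : 0 ≤ L)
    (hη : 0 ≤ η) (hε : 0 ≤ ε) (hσ : 0 < σ)
    (hU : ∀ x : EuclideanSpace ℝ (Fin n × Fin r),
      ‖Matrix.toEuclideanLin (matU A Z) x‖ ≤ σ * ‖x‖)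
    (x₀ : EuclideanSpace ℝ (Fin n × Fin r)) (t : ℕ)
    (ht : 4 * L ^ l / σ ^ l * (ε * (1 + 4 * η * σ ^ l) ^ t * ‖x₀‖ ^ l) ^ 2 ≤ 1) :
    AtomBd (4 * L ^ l / σ ^ l * (ε * (1 + 4 * η * σ ^ l) ^ t * ‖x₀‖ ^ l) ^ 3)
      (gd l A Z η ε x₀ t - ε • lin l A Z η t x₀) := by
  set α := 1 + 4 * η * σ ^ l with hα
  have hα1 : 1 ≤ α := by rw [hα]; linarith [show 0 ≤ 4 * η * σ ^ l by positivity]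
  have hα0 : 0 < α := by linarith
  set Q := 4 * L ^ l / σ ^ l with hQ
  have hQ0 : 0 ≤ Q := by positivity
  induction t with
  | zero =>
    refine AtomBd.mono (C := 0) ?_ (by positivity)
    simpa [gd, lin] using AtomBd.zero
  | succ t ih =>
    set p := ε * α ^ t * ‖x₀‖ ^ l with hp
    have hp0 : 0 ≤ p := by positivity
    have hpα : ε * α ^ (t + 1) * ‖x₀‖ ^ l = α * p := by rw [hp]; ring
    rw [hpα] at ht ⊢
    have hp1 : Q * p ^ 2 ≤ 1 := by
      refine le_trans ?_ ht
      gcongr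
      exact le_mul_of_one_le_left hp0 hα1
    have he := ih hp1
    have hl := atomBd_lin hη hσ.le hU t x₀ (l := l) (A := A) (Z := Z)
    have hw : AtomBd (2 * p) (gd l A Z η ε x₀ t) := by
      have := he.add (hl.smul ε)
      rw [sub_add_cancel] at this
      refine this.mono ?_
      rw [abs_of_nonneg hε, ← hα, ← mul_assoc, ← hp]
      nlinarith
    have hc := hR.atomBd_cubic hL hw hw hw
    have hstep : gd l A Z η ε x₀ (t + 1) - ε • lin l A Z η (t + 1) x₀ =
        (gd l A Z η ε x₀ t - ε • lin l A Z η t x₀) +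
          (4 * η) • liftU l A Z (gd l A Z η ε x₀ t - ε • lin l A Z η t x₀) -
        (4 * η) • cubic A (gd l A Z η ε x₀ t) (gd l A Z η ε x₀ t) (gd l A Z η ε x₀ t) := by
      rw [gd_succ hA, lin_succ, map_sub, map_smul]
      module
    rw [hstep]
    refine ((he.add ((he.map_le hσ.le (liftU_rankOne A Z) hU).smul (4 * η))).sub
      (hc.smul (4 * η))).mono ?_
    rw [abs_of_nonneg (by positivity : 0 ≤ 4 * η)]
    have h1 : 32 * η * L ^ l = Q * (2 * (α - 1)) := by
      rw [hQ, hα]; field_simp; ring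
    have h2 : 2 * (α - 1) ≤ α ^ 3 - α := by
      nlinarith [mul_nonneg (sub_nonneg.2 hα1) (sub_nonneg.2 hα1)]
    calc Q * p ^ 3 + 4 * η * (σ ^ l * (Q * p ^ 3)) + 4 * η * (L ^ l * (2 * p * (2 * p) * (2 * p)))
        = α * (Q * p ^ 3) + (32 * η * L ^ l) * p ^ 3 := by rw [hα]; ring
      _ = α * (Q * p ^ 3) + Q * (2 * (α - 1)) * p ^ 3 := by rw [h1]
      _ ≤ α * (Q * p ^ 3) + Q * (α ^ 3 - α) * p ^ 3 := by gcongr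
      _ = Q * (α * p) ^ 3 := by ring

end Linearization

section SpectralTheory

lemma norm_apply_le_singularValues {E : Type} [NormedAddCommGroup E] [InnerProductSpace ℝ E]
    [FiniteDimensional ℝ E] (T : E →ₗ[ℝ] E) (k : ℕ) (x : E)
    (hx : ∀ i : Fin (Module.finrank ℝ E), (i : ℕ) < k →
      ⟪T.isSymmetric_adjoint_comp_self.eigenvectorBasis rfl i, x⟫ = 0) :
    ‖T x‖ ≤ T.singularValues k * ‖x‖ := by
  set b := T.isSymmetric_adjoint_comp_self.eigenvectorBasis rfl with hb
  have h1 : ‖T x‖ ^ 2 = ∑ i : Fin (Module.finrank ℝ E), T.singularValues i ^ 2 * ⟪b i, x⟫ ^ 2 := by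
    rw [← real_inner_self_eq_norm_sq, ← LinearMap.adjoint_inner_right, ← b.sum_inner_mul_inner]
    refine Finset.sum_congr rfl fun i _ => ?_
    have h2 : ⟪b i, (T.adjoint ∘ₗ T) x⟫ = T.singularValues i ^ 2 * ⟪b i, x⟫ := by
      rw [← T.isSymmetric_adjoint_comp_self (b i) x, hb,
        LinearMap.IsSymmetric.apply_eigenvectorBasis, T.sq_singularValues_fin rfl]
      simp [real_inner_smul_left]
    rw [show T.adjoint (T x) = (T.adjoint ∘ₗ T) x from rfl, h2, real_inner_comm]
    ring
  have h3 : ‖x‖ ^ 2 = ∑ i, ⟪b i, x⟫ ^ 2 := (b.sum_sq_inner_right x).symm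
  refine le_of_sq_le_sq ?_ (mul_nonneg (T.singularValues_nonneg k) (norm_nonneg _))
  rw [mul_pow, h1, h3, Finset.mul_sum]
  refine Finset.sum_le_sum fun i _ => ?_
  rcases lt_or_ge (i : ℕ) k with hi | hi
  · simp [hx i hi]
  · have := T.singularValues_antitone hi
    have h0 := T.singularValues_nonneg i
    gcongr

lemma norm_apply_le_singularValues_zero {E : Type} [NormedAddCommGroup E] [InnerProductSpace ℝ E]
    [FiniteDimensional ℝ E] (T : E →ₗ[ℝ] E) (x : E) : ‖T x‖ ≤ T.singularValues 0 * ‖x‖ :=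
  norm_apply_le_singularValues T 0 x fun _ h => absurd h (Nat.not_lt_zero _)

/-- The easy half of the min-max principle for singular values. -/
lemma exists_norm_apply_le_singularValues {E V : Type} [NormedAddCommGroup E]
    [InnerProductSpace ℝ E] [FiniteDimensional ℝ E] [AddCommGroup V] [Module ℝ V]
    [FiniteDimensional ℝ V] (T : E →ₗ[ℝ] E) (Φ : V →ₗ[ℝ] E) {k : ℕ}
    (hk : k < Module.finrank ℝ V) :
    ∃ x, x ≠ 0 ∧ ‖T (Φ x)‖ ≤ T.singularValues k * ‖Φ x‖ := by
  classical
  let b := T.isSymmetric_adjoint_comp_self.eigenvectorBasis rfl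
  let Ψ : V →ₗ[ℝ] (Fin k → ℝ) := LinearMap.pi fun i =>
    if h : (i : ℕ) < Module.finrank ℝ E then (innerₛₗ ℝ (b ⟨i, h⟩)) ∘ₗ Φ else 0
  have hker : LinearMap.ker Ψ ≠ ⊥ := LinearMap.ker_ne_bot_of_finrank_lt (by simpa using hk)
  obtain ⟨x, hx, hx0⟩ := (Submodule.ne_bot_iff _).1 hker
  refine ⟨x, hx0, norm_apply_le_singularValues T k _ fun i hi => ?_⟩
  have := congrFun (LinearMap.mem_ker.1 hx) ⟨i, hi⟩
  simpa [Ψ, b] using this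

lemma exists_pos_eigenvector {E : Type} [NormedAddCommGroup E] [InnerProductSpace ℝ E]
    [FiniteDimensional ℝ E] {T : E →ₗ[ℝ] E} (hT : T.IsSymmetric) {x : E} (hx : 0 < ⟪x, T x⟫) :
    ∃ (v : E) (μ : ℝ), ‖v‖ = 1 ∧ 0 < μ ∧ T v = μ • v := by
  by_contra! hcon
  set b := hT.eigenvectorBasis rfl with hb
  have hi : ∀ i, hT.eigenvalues rfl i ≤ 0 := by
    intro i
    by_contra! hpos
    exact hcon (b i) _ (b.norm_eq_one i) hpos (by
      rw [hb, LinearMap.IsSymmetric.apply_eigenvectorBasis]; rfl)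
  rw [← b.sum_inner_mul_inner] at hx
  refine hx.not_ge (Finset.sum_nonpos fun i _ => ?_)
  rw [← hT (b i) x, hb, LinearMap.IsSymmetric.apply_eigenvectorBasis]
  simp only [RCLike.ofReal_real_eq_id, id, real_inner_smul_left]
  rw [real_inner_comm, ← hb]
  nlinarith [hi i, sq_nonneg ⟪b i, x⟫]

end SpectralTheory

section TopSingularSpace

variable {n m r : ℕ} {A : Fin m → Matrix (Fin n) (Fin n) ℝ} {Z : Matrix (Fin n) (Fin r) ℝ}

lemma norm_matU_le (x : EuclideanSpace ℝ (Fin n × Fin r)) :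
    ‖Matrix.toEuclideanLin (matU A Z) x‖ ≤ sigma1 A Z * ‖x‖ :=
  norm_apply_le_singularValues_zero _ x

lemma sigma2_nonneg (A : Fin m → Matrix (Fin n) (Fin n) ℝ) (Z : Matrix (Fin n) (Fin r) ℝ) :
    0 ≤ sigma2 A Z := LinearMap.singularValues_nonneg _ _

lemma matU_ne_zero (h : sigma2 A Z < sigma1 A Z) : matU A Z ≠ 0 := by
  intro h0
  have : sigma1 A Z = 0 := by simp [sigma1, h0]
  linarith [sigma2_nonneg A Z]

lemma sum_sq_meas_pos (h : sigma2 A Z < sigma1 A Z) : 0 < ∑ k, meas A Z k ^ 2 := by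
  by_contra! h0
  have h1 : ∀ k, meas A Z k = 0 := fun k => by
    have := (Finset.sum_eq_zero_iff_of_nonneg fun k _ => sq_nonneg (meas A Z k)).1
      (le_antisymm h0 (Finset.sum_nonneg fun _ _ => sq_nonneg _)) k (Finset.mem_univ k)
    exact pow_eq_zero_iff two_ne_zero |>.1 this
  exact matU_ne_zero h (by simp [matU, h1])

lemma RSS.pos {L : ℝ} (hR : RSS A Z L) (h : sigma2 A Z < sigma1 A Z) : 0 < L := by
  have h1 := hR.sum_sq_sense_le (M := Z * Zᵀ)
    ((Matrix.rank_mul_le_left _ _).trans (Matrix.rank_le_width _))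
  have h2 : 0 < L * ∑ i, ∑ j, (Z * Zᵀ) i j ^ 2 := (sum_sq_meas_pos h).trans_le h1
  exact pos_of_mul_pos_left h2 (Finset.sum_nonneg fun _ _ => Finset.sum_nonneg fun _ _ =>
    sq_nonneg _)

lemma exists_pos_eigenvector_matU (hA : ∀ k, (A k).IsSymm) (h : sigma2 A Z < sigma1 A Z) :
    ∃ (v : EuclideanSpace ℝ (Fin n × Fin r)) (μ : ℝ), ‖v‖ = 1 ∧ 0 < μ ∧
      Matrix.toEuclideanLin (matU A Z) v = μ • v := by
  refine exists_pos_eigenvector (fun x y => inner_toEuclideanLin (matU_isSymm hA Z) x y)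
    (x := WithLp.toLp 2 fun p : Fin n × Fin r => Z p.1 p.2) ?_
  rw [matU_eq_sum]
  simp only [map_sum, map_smul, LinearMap.sum_apply, LinearMap.smul_apply, inner_sum,
    real_inner_smul_right, inner_ampMat]
  refine (sum_sq_meas_pos h).trans_eq (Finset.sum_congr rfl fun k _ => ?_)
  rw [sq]
  rfl

/-- A symmetric matrix whose square has the eigenvalue `σ²` has the eigenvalue `σ` or `-σ`. -/
lemma exists_unit_eigenvector {B : Matrix (Fin n) (Fin n) ℝ} {q : Fin n → ℝ} {σ : ℝ} (hq : q ≠ 0)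
    (hB : B *ᵥ (B *ᵥ q) = σ ^ 2 • q) :
    ∃ (u : Fin n → ℝ) (c : ℝ), u ⬝ᵥ u = 1 ∧ c ^ 2 = σ ^ 2 ∧ B *ᵥ u = c • u := by
  have key : ∃ (u : Fin n → ℝ) (c : ℝ), u ≠ 0 ∧ c ^ 2 = σ ^ 2 ∧ B *ᵥ u = c • u := by
    by_cases he : B *ᵥ q + σ • q = 0
    · exact ⟨q, -σ, hq, by ring, by rw [neg_smul]; exact eq_neg_of_add_eq_zero_left he⟩
    · refine ⟨_, σ, he, rfl, ?_⟩
      rw [Matrix.mulVec_add, hB, Matrix.mulVec_smul, smul_add, smul_smul, sq, add_comm]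
  obtain ⟨u, c, hu, hc, hBu⟩ := key
  have hpos : 0 < u ⬝ᵥ u := lt_of_le_of_ne (Finset.sum_nonneg fun i _ => mul_self_nonneg _)
    (Ne.symm (by simpa using hu))
  refine ⟨(√(u ⬝ᵥ u))⁻¹ • u, c, ?_, hc, ?_⟩
  · rw [smul_dotProduct, dotProduct_smul, smul_eq_mul, smul_eq_mul, ← mul_assoc, ← mul_inv,
      Real.mul_self_sqrt hpos.le, inv_mul_cancel₀ hpos.ne']
  · rw [Matrix.mulVec_smul, hBu, smul_comm]

end TopSingularSpace

section TopProjection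

variable {n m r : ℕ} {A : Fin m → Matrix (Fin n) (Fin n) ℝ} {Z : Matrix (Fin n) (Fin r) ℝ}

lemma toEuclideanLin_toEuclideanLin {κ : Type} [Fintype κ] [DecidableEq κ] (M N : Matrix κ κ ℝ)
    (x : EuclideanSpace ℝ κ) :
    Matrix.toEuclideanLin M (Matrix.toEuclideanLin N x) = Matrix.toEuclideanLin (M * N) x := by
  simp [Matrix.toLpLin_apply, Matrix.mulVec_mulVec]

lemma kronecker_one_mulVec (B : Matrix (Fin n) (Fin n) ℝ) (x : Fin n × Fin r → ℝ)
    (i : Fin n) (s : Fin r) :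
    ((B ⊗ₖ (1 : Matrix (Fin r) (Fin r) ℝ)) *ᵥ x) (i, s) = (B *ᵥ fun j => x (j, s)) i := by
  simp [Matrix.mulVec, dotProduct, Fintype.sum_prod_type, Matrix.one_apply]

/-- The vectorization of `q cᵀ`. -/
def outer (q : Fin n → ℝ) : (Fin r → ℝ) →ₗ[ℝ] EuclideanSpace ℝ (Fin n × Fin r) where
  toFun c := WithLp.toLp 2 fun p => q p.1 * c p.2
  map_add' c d := by ext p; simp [mul_add]
  map_smul' a c := by ext p; simp; ring

/-- The orthogonal projection `q qᵀ ⊗ I` onto the vectorizations of the matrices `q cᵀ`. -/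
def outerProj (q : Fin n → ℝ) (r : ℕ) : Matrix (Fin n × Fin r) (Fin n × Fin r) ℝ :=
  Matrix.vecMulVec q q ⊗ₖ 1

lemma outerProj_isSymm (q : Fin n → ℝ) : (outerProj q r).IsSymm := by
  ext ⟨i, s⟩ ⟨j, s'⟩
  simp [outerProj, Matrix.vecMulVec_apply, Matrix.one_apply, eq_comm, mul_comm]

lemma outerProj_mul_self {q : Fin n → ℝ} (hq : q ⬝ᵥ q = 1) :
    outerProj q r * outerProj q r = outerProj q r := by
  rw [outerProj, ← Matrix.mul_kronecker_mul, Matrix.vecMulVec_mul_vecMulVec, hq]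
  simp

lemma outerProj_outer {q : Fin n → ℝ} (hq : q ⬝ᵥ q = 1) (c : Fin r → ℝ) :
    Matrix.toEuclideanLin (outerProj q r) (outer q c) = outer q c := by
  ext ⟨i, s⟩
  rw [Matrix.toLpLin_apply]
  change ((outerProj q r) *ᵥ _) (i, s) = _
  rw [outerProj, kronecker_one_mulVec]
  have : ∑ j, q j * q j = 1 := hq
  simp only [outer, Matrix.mulVec, dotProduct, Matrix.vecMulVec_apply, LinearMap.coe_mk,
    AddHom.coe_mk]
  calc ∑ j, q i * q j * (q j * c s) = q i * c s * ∑ j, q j * q j := by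
        rw [Finset.mul_sum]; exact Finset.sum_congr rfl fun j _ => by ring
    _ = q i * c s := by rw [this, mul_one]

lemma outer_injective {q : Fin n → ℝ} (hq : q ⬝ᵥ q = 1) {c : Fin r → ℝ} (h : outer q c = 0) :
    c = 0 := by
  have hq0 : q ≠ 0 := by rintro rfl; simp at hq
  obtain ⟨i, hi⟩ := Function.ne_iff.1 hq0
  ext s
  have := congrArg (fun x : EuclideanSpace ℝ (Fin n × Fin r) => x (i, s)) h
  simpa [outer, show q i ≠ 0 from hi] using this

/-- The symmetric matrix `U` acts as a scalar `± σ₁` on a subspace containing all its top singular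
vectors, and has norm at most `σ₂` on the orthogonal complement. -/
lemma exists_topProjection (hA : ∀ k, (A k).IsSymm) (h : sigma2 A Z < sigma1 A Z)
    {v₁ : EuclideanSpace ℝ (Fin n × Fin r)} (hv : IsTopSingularVector A Z v₁) :
    ∃ (P : EuclideanSpace ℝ (Fin n × Fin r) →ₗ[ℝ] EuclideanSpace ℝ (Fin n × Fin r)) (c : ℝ),
      c ^ 2 = sigma1 A Z ^ 2 ∧ (∀ x y, ⟪P x, y⟫ = ⟪x, P y⟫) ∧ (∀ x, P (P x) = P x) ∧
      (∀ x, Matrix.toEuclideanLin (matU A Z) (P x) = c • P x) ∧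
      (∀ x, P (Matrix.toEuclideanLin (matU A Z) x) = Matrix.toEuclideanLin (matU A Z) (P x)) ∧
      (∀ z, P z = 0 → ‖Matrix.toEuclideanLin (matU A Z) z‖ ≤ sigma2 A Z * ‖z‖) ∧
      P v₁ = v₁ := by
  obtain ⟨hv1, hveq⟩ := hv
  have hσ2 := sigma2_nonneg A Z
  set U := Matrix.toEuclideanLin (matU A Z) with hU
  set B := ∑ k, meas A Z k • A k with hB
  have hUB : matU A Z = B ⊗ₖ (1 : Matrix (Fin r) (Fin r) ℝ) := rfl
  have hBs : Bᵀ = B := by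
    ext i j
    simp only [hB, Matrix.transpose_apply, Matrix.sum_apply, Matrix.smul_apply, (hA _).apply i j]
  have hUsymm := inner_toEuclideanLin (matU_isSymm hA Z)
  rw [(matU_isSymm hA Z).eq, ← Matrix.mulVec_mulVec] at hveq
  have hUU : U (U v₁) = sigma1 A Z ^ 2 • v₁ := by
    ext p; exact congrFun hveq p
  have hv0 : v₁ ≠ 0 := by rintro rfl; simp at hv1
  obtain ⟨⟨i₀, s₀⟩, hi⟩ : ∃ p, v₁ p ≠ 0 := by
    by_contra! h0
    exact hv0 (by ext p; simpa using h0 p)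
  obtain ⟨q, c, hq, hc, hBq⟩ := exists_unit_eigenvector (B := B) (q := fun j => v₁ (j, s₀))
    (σ := sigma1 A Z) (fun h0 => hi (congrFun h0 i₀)) (by
      ext i
      have := congrFun hveq (i, s₀)
      rw [hUB, kronecker_one_mulVec] at this
      simp only [kronecker_one_mulVec] at this
      exact this)
  set P := Matrix.toEuclideanLin (outerProj q r) with hP
  have hPs := inner_toEuclideanLin (outerProj_isSymm (r := r) q)
  have hPP : ∀ x, P (P x) = P x := fun x => by
    rw [hP, toEuclideanLin_toEuclideanLin, outerProj_mul_self hq]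
  have hqB : q ᵥ* B = c • q := by rw [← Matrix.mulVec_transpose, hBs, hBq]
  have hUPm : matU A Z * outerProj q r = c • outerProj q r := by
    rw [hUB, outerProj, ← Matrix.mul_kronecker_mul, Matrix.mul_vecMulVec, hBq,
      Matrix.smul_vecMulVec, one_mul, Matrix.smul_kronecker]
  have hPUm : outerProj q r * matU A Z = c • outerProj q r := by
    rw [hUB, outerProj, ← Matrix.mul_kronecker_mul, Matrix.vecMulVec_mul, hqB,
      Matrix.vecMulVec_smul, one_mul, Matrix.smul_kronecker]
  have hUP : ∀ x, U (P x) = c • P x := fun x => by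
    rw [hU, hP, toEuclideanLin_toEuclideanLin, hUPm, map_smul, LinearMap.smul_apply]
  have hPU : ∀ x, P (U x) = U (P x) := fun x => by
    rw [hUP, hU, hP, toEuclideanLin_toEuclideanLin, hPUm, map_smul, LinearMap.smul_apply]
  have horth : ∀ x z, P z = 0 → ⟪P x, z⟫ = 0 := fun x z hz => by
    rw [hPs, ← hP, hz, inner_zero_right]
  have hnorm : ∀ z, P z = 0 → ‖U z‖ ≤ sigma2 A Z * ‖z‖ := by
    intro z hz
    by_contra! hlt
    let Φ : ((Fin r → ℝ) × ℝ) →ₗ[ℝ] EuclideanSpace ℝ (Fin n × Fin r) :=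
      (outer q).coprod (LinearMap.toSpanSingleton ℝ _ z)
    obtain ⟨⟨d, t⟩, hne, hle⟩ := exists_norm_apply_le_singularValues U Φ (k := r) (by simp)
    have hΦ : Φ (d, t) = outer q d + t • z := rfl
    have hPd : P (outer q d) = outer q d := outerProj_outer hq d
    have hUd : U (outer q d) = c • outer q d := by rw [← hPd, hUP]
    have hPUz : P (U z) = 0 := by rw [hPU, hz, map_zero]
    have h1 : ‖Φ (d, t)‖ ^ 2 = ‖outer q d‖ ^ 2 + t ^ 2 * ‖z‖ ^ 2 := by
      rw [hΦ, norm_add_sq_real, real_inner_smul_right, ← hPd, horth _ _ hz, norm_smul, mul_pow,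
        Real.norm_eq_abs, sq_abs]
      ring
    have h2 : ‖U (Φ (d, t))‖ ^ 2 = c ^ 2 * ‖outer q d‖ ^ 2 + t ^ 2 * ‖U z‖ ^ 2 := by
      rw [hΦ, map_add, map_smul, hUd, norm_add_sq_real, real_inner_smul_right,
        real_inner_smul_left, ← hPd, horth _ _ hPUz, norm_smul, norm_smul, mul_pow, mul_pow,
        Real.norm_eq_abs, sq_abs, Real.norm_eq_abs, sq_abs]
      ring
    have h3 : ‖U (Φ (d, t))‖ ^ 2 ≤ sigma2 A Z ^ 2 * ‖Φ (d, t)‖ ^ 2 := by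
      rw [← mul_pow]
      exact pow_le_pow_left₀ (norm_nonneg _) hle 2
    rw [h1, h2, hc] at h3
    have h4 : sigma2 A Z ^ 2 < sigma1 A Z ^ 2 := pow_lt_pow_left₀ h hσ2 two_ne_zero
    have h5 : sigma2 A Z ^ 2 * ‖z‖ ^ 2 < ‖U z‖ ^ 2 := by
      rw [← mul_pow]
      exact pow_lt_pow_left₀ hlt (by positivity) two_ne_zero
    have h6 : t ^ 2 = 0 := by
      by_contra h0
      have : 0 < t ^ 2 := lt_of_le_of_ne (sq_nonneg t) (Ne.symm h0)
      nlinarith [mul_pos this (sub_pos.2 h5), mul_nonneg (sub_pos.2 h4).le (sq_nonneg ‖outer q d‖)]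
    have h7 : ‖outer q d‖ ^ 2 = 0 := by
      by_contra h0
      have : 0 < ‖outer q d‖ ^ 2 := lt_of_le_of_ne (sq_nonneg _) (Ne.symm h0)
      rw [h6] at h3
      nlinarith [mul_pos (sub_pos.2 h4) this]
    refine hne (Prod.ext (outer_injective hq ?_) (by simpa using h6))
    simpa using h7
  refine ⟨P, c, hc, hPs, hPP, hUP, hPU, hnorm, ?_⟩
  have hz : P (v₁ - P v₁) = 0 := by rw [map_sub, hPP, sub_self]
  have h1 : U (U (v₁ - P v₁)) = sigma1 A Z ^ 2 • (v₁ - P v₁) := by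
    rw [map_sub, map_sub, hUU, ← hPU, ← hPU, hUU, map_smul, smul_sub]
  have h2 : ‖U (v₁ - P v₁)‖ ^ 2 = sigma1 A Z ^ 2 * ‖v₁ - P v₁‖ ^ 2 := by
    rw [← real_inner_self_eq_norm_sq, hU, hUsymm, ← hU, h1, real_inner_smul_right,
      real_inner_self_eq_norm_sq]
  have h3 : ‖U (v₁ - P v₁)‖ ^ 2 ≤ sigma2 A Z ^ 2 * ‖v₁ - P v₁‖ ^ 2 := by
    rw [← mul_pow]
    exact pow_le_pow_left₀ (norm_nonneg _) (hnorm _ hz) 2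
  have h4 : sigma2 A Z ^ 2 < sigma1 A Z ^ 2 := pow_lt_pow_left₀ h hσ2 two_ne_zero
  have h5 : ‖v₁ - P v₁‖ ^ 2 = 0 := by
    by_contra h0
    have : 0 < ‖v₁ - P v₁‖ ^ 2 := lt_of_le_of_ne (sq_nonneg _) (Ne.symm h0)
    nlinarith [mul_pos (sub_pos.2 h4) this]
  have h6 : v₁ - P v₁ = 0 := by simpa using h5
  exact (sub_eq_zero.1 h6).symm

lemma one_le_rank_matU (h : sigma2 A Z < sigma1 A Z) : 1 ≤ (matU A Z).rank := by
  rw [Nat.one_le_iff_ne_zero]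
  intro h0
  rw [Matrix.rank, Submodule.finrank_eq_zero, LinearMap.range_eq_bot] at h0
  refine matU_ne_zero h (Matrix.ext_of_mulVec_single fun i => ?_)
  rw [Matrix.zero_mulVec]
  exact LinearMap.congr_fun h0 _

lemma one_le_dims (h : sigma2 A Z < sigma1 A Z) : 1 ≤ n ∧ 1 ≤ r := by
  have hne := matU_ne_zero h
  obtain ⟨⟨i, s⟩, -⟩ : ∃ p, (matU A Z) p ≠ 0 := by
    by_contra! h0
    exact hne (funext h0)
  exact ⟨i.pos, s.pos⟩

end TopProjection

section VariationalEigenvalues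

variable {l : ℕ} {ι : Type} [Fintype ι]

lemma rankOne_ne_zero {u : EuclideanSpace ℝ ι} (hu : u ≠ 0) : rankOne l u ≠ 0 := by
  rw [← norm_ne_zero_iff, norm_rankOne]
  exact pow_ne_zero _ (norm_ne_zero_iff.2 hu)

lemma exists_mem_span_inner_eq_zero {E : Type} [NormedAddCommGroup E] [InnerProductSpace ℝ E]
    {a b : E} (ha : a ≠ 0) (hb : b ≠ 0) (hab : ⟪a, b⟫ = 0) (w : E) {S : Submodule ℝ E}
    (haS : a ∈ S) (hbS : b ∈ S) : ∃ v ∈ S, ‖v‖ = 1 ∧ ⟪w, v⟫ = 0 := by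
  obtain ⟨v, hvS, hv0, hv⟩ : ∃ v ∈ S, v ≠ 0 ∧ ⟪w, v⟫ = 0 := by
    by_cases h : ⟪w, a⟫ = 0
    · exact ⟨a, haS, ha, h⟩
    · refine ⟨⟪w, a⟫ • b - ⟪w, b⟫ • a, S.sub_mem (S.smul_mem _ hbS) (S.smul_mem _ haS), ?_, ?_⟩
      · intro h0
        have := congrArg (fun x => ⟪x, b⟫) h0
        simp only [inner_sub_left, real_inner_smul_left, hab, mul_zero, sub_zero, inner_zero_left,
          mul_eq_zero, h, false_or, inner_self_eq_zero] at this
        exact hb this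
      · simp only [inner_sub_right, real_inner_smul_right]; ring
  refine ⟨‖v‖⁻¹ • v, S.smul_mem _ hvS, ?_, by rw [real_inner_smul_right, hv, mul_zero]⟩
  rw [norm_smul, norm_inv, norm_norm, inv_mul_cancel₀ (norm_ne_zero_iff.2 hv0)]

lemma sInf_abs_le {E : Type} [NormedAddCommGroup E] [InnerProductSpace ℝ E] {S : Submodule ℝ E}
    (f : E → ℝ) {v : E} (hv : v ∈ S) (hv1 : ‖v‖ = 1) :
    sInf {y | ∃ x ∈ S, ‖x‖ = 1 ∧ y = |f x|} ≤ |f v| := by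
  refine csInf_le ⟨0, ?_⟩ ⟨v, hv, hv1, rfl⟩
  rintro y ⟨T, -, -, rfl⟩
  exact abs_nonneg _

/-- A linear functional vanishes somewhere on the unit sphere of a two-dimensional space. -/
lemma vEig_two_le_zero (w : Tensor l ι) : vEig 2 w ≤ 0 := by
  refine Real.sSup_nonpos ?_
  rintro c ⟨u, hu, horth, rfl⟩
  have hmem : ∀ i, rankOne l (u i) ∈ Submodule.span ℝ (Set.range fun i => rankOne l (u i)) :=
    fun i => Submodule.subset_span (Set.mem_range_self i)
  obtain ⟨T, hT, hT1, hw⟩ := exists_mem_span_inner_eq_zero (rankOne_ne_zero (l := l) (hu 0))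
    (rankOne_ne_zero (hu 1)) (horth 0 1 (by simp)) w (hmem 0) (hmem 1)
  refine (sInf_abs_le (fun T => ⟪w, T⟫) hT hT1).trans ?_
  rw [hw, abs_zero]

lemma vEig_one_pos {w : Tensor l ι} {u : EuclideanSpace ℝ ι} (hu : u ≠ 0)
    (hw : ⟪w, rankOne l u⟫ ≠ 0) : 0 < vEig 1 w := by
  have hne : ∀ v : EuclideanSpace ℝ ι, v ≠ 0 → ‖‖rankOne l v‖⁻¹ • rankOne l v‖ = 1 := by
    intro v hv
    rw [norm_smul, norm_inv, norm_norm,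
      inv_mul_cancel₀ (norm_ne_zero_iff.2 (rankOne_ne_zero hv))]
  have hbdd : BddAbove {c | ∃ u : Fin 1 → EuclideanSpace ℝ ι, (∀ i, u i ≠ 0) ∧
      (∀ i j, i ≠ j → ⟪rankOne l (u i), rankOne l (u j)⟫ = 0) ∧
      c = sInf {y | ∃ T ∈ Submodule.span ℝ (Set.range fun i => rankOne l (u i)),
        ‖T‖ = 1 ∧ y = |⟪w, T⟫|}} := by
    refine ⟨‖w‖, ?_⟩
    rintro c ⟨v, hv, -, rfl⟩
    have hmem : rankOne l (v 0) ∈ Submodule.span ℝ (Set.range fun i => rankOne l (v i)) :=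
      Submodule.subset_span (Set.mem_range_self 0)
    refine (sInf_abs_le (fun T => ⟪w, T⟫) (Submodule.smul_mem _ (‖rankOne l (v 0)‖⁻¹) hmem)
      (hne _ (hv 0))).trans ((abs_real_inner_le_norm _ _).trans_eq ?_)
    rw [hne _ (hv 0), mul_one]
  refine lt_of_lt_of_le (?_ : 0 < |⟪w, rankOne l u⟫| / ‖rankOne l u‖)
    (le_csSup_of_le hbdd ⟨fun _ => u, fun _ => hu, fun i j hij =>
      absurd (Subsingleton.elim i j) hij, rfl⟩ (le_csInf ⟨_, _, Submodule.smul_mem _ (‖rankOne l u‖⁻¹)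
        (Submodule.subset_span (Set.mem_range_self 0)), hne u hu, rfl⟩ ?_))
  · exact div_pos (abs_pos.2 hw) (norm_pos_iff.2 (rankOne_ne_zero hu))
  · rintro y ⟨T, hT, hT1, rfl⟩
    rw [Set.range_const, Submodule.mem_span_singleton] at hT
    obtain ⟨a, rfl⟩ := hT
    rw [norm_smul, Real.norm_eq_abs] at hT1
    rw [real_inner_smul_right, abs_mul, eq_div_of_mul_eq
      (norm_ne_zero_iff.2 (rankOne_ne_zero hu)) hT1]
    exact le_of_eq (by ring)

lemma abs_inner_rankOne_le (w : Tensor l ι) {v : EuclideanSpace ℝ ι} (hv : ‖v‖ = 1) :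
    |⟪w, rankOne l v⟫| ≤ ‖w‖ := by
  simpa [norm_rankOne, hv] using abs_real_inner_le_norm w (rankOne l v)

lemma le_vEigRankOne_one (w : Tensor l ι) {v : EuclideanSpace ℝ ι} (hv : ‖v‖ = 1) :
    |⟪w, rankOne l v⟫| ≤ vEigRankOne 1 w := by
  have hv0 : v ≠ 0 := by rintro rfl; simp at hv
  have hbdd : BddAbove {c | ∃ V : Submodule ℝ (EuclideanSpace ℝ ι), Module.finrank ℝ V = 1 ∧
      c = sInf {y | ∃ v ∈ V, ‖v‖ = 1 ∧ y = |⟪w, rankOne l v⟫|}} := by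
    refine ⟨‖w‖, ?_⟩
    rintro c ⟨V, hV, rfl⟩
    have : Nontrivial V := Module.nontrivial_of_finrank_eq_succ hV
    obtain ⟨x, hx⟩ := exists_norm_eq V zero_le_one
    exact (sInf_abs_le (fun v => ⟪w, rankOne l v⟫) x.2 hx).trans (abs_inner_rankOne_le w hx)
  refine le_csSup_of_le hbdd ⟨ℝ ∙ v, finrank_span_singleton hv0, rfl⟩
    (le_csInf ⟨_, v, Submodule.mem_span_singleton_self v, hv, rfl⟩ ?_)
  rintro y ⟨x, hx, hx1, rfl⟩
  obtain ⟨a, rfl⟩ := Submodule.mem_span_singleton.1 hx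
  rw [norm_smul, hv, mul_one, Real.norm_eq_abs] at hx1
  rw [rankOne_smul, real_inner_smul_right, abs_mul, abs_pow, hx1, one_pow, one_mul]

lemma vEigRankOne_two_le {w : Tensor l ι} {D : ℝ} (hD : 0 ≤ D)
    (h : ∀ a b : EuclideanSpace ℝ ι, ‖a‖ = 1 → ‖b‖ = 1 → ⟪a, b⟫ = 0 →
      ∃ v ∈ Submodule.span ℝ {a, b}, ‖v‖ = 1 ∧ |⟪w, rankOne l v⟫| ≤ D) :
    vEigRankOne 2 w ≤ D := by
  refine Real.sSup_le ?_ hD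
  rintro c ⟨V, hV, rfl⟩
  let e := (stdOrthonormalBasis ℝ V).reindex (finCongr hV)
  obtain ⟨v, hv, hv1, hle⟩ := h (e 0) (e 1) (e.norm_eq_one 0) (e.norm_eq_one 1)
    (e.inner_eq_zero (by simp))
  refine (sInf_abs_le (fun v => ⟪w, rankOne l v⟫) (Submodule.span_le.2 ?_ hv) hv1).trans hle
  rintro x (rfl | rfl) <;> exact Subtype.property _

lemma continuous_rankOne : Continuous (rankOne l : EuclideanSpace ℝ ι → Tensor l ι) := by
  refine (PiLp.continuous_toLp 2 _).comp (continuous_pi fun i => ?_)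
  fun_prop

/-- An odd form vanishes somewhere on the unit circle. -/
lemma vEigRankOne_two_le_zero (hl : Odd l) (w : Tensor l ι) : vEigRankOne 2 w ≤ 0 := by
  refine vEigRankOne_two_le le_rfl fun a b ha hb hab => ?_
  let γ : ℝ → EuclideanSpace ℝ ι := fun s => Real.cos s • a + Real.sin s • b
  have hγ : Continuous γ := by fun_prop
  let f : ℝ → ℝ := fun s => ⟪w, rankOne l (γ s)⟫
  have hf : Continuous f := continuous_const.inner (continuous_rankOne.comp hγ)
  have hπ : f Real.pi = -f 0 := by
    have : γ Real.pi = (-1 : ℝ) • γ 0 := by simp [γ]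
    simp only [f]
    rw [this, rankOne_smul, hl.neg_one_pow, real_inner_smul_right]
    ring
  have h0 : (0 : ℝ) ∈ Set.uIcc (f 0) (f Real.pi) := by
    rw [hπ, Set.mem_uIcc]
    rcases le_total 0 (f 0) with h | h
    · exact Or.inr ⟨by linarith, h⟩
    · exact Or.inl ⟨h, by linarith⟩
  obtain ⟨s, -, hs⟩ := intermediate_value_uIcc hf.continuousOn h0
  refine ⟨γ s, Submodule.add_mem _ (Submodule.smul_mem _ _ (Submodule.subset_span (by simp)))
    (Submodule.smul_mem _ _ (Submodule.subset_span (by simp))), ?_, ?_⟩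
  · have : ‖γ s‖ ^ 2 = 1 := by
      rw [norm_add_sq_real, real_inner_smul_left, real_inner_smul_right, hab, norm_smul, norm_smul,
        ha, hb]
      simp
    exact (pow_eq_one_iff_of_nonneg (norm_nonneg _) two_ne_zero).1 this
  · exact (by rw [show ⟪w, rankOne l (γ s)⟫ = 0 from hs, abs_zero] : |⟪w, rankOne l (γ s)⟫| = 0).le

end VariationalEigenvalues

section Scalars

lemma log_one_add_le_div_sqrt {z : ℝ} (hz : 0 ≤ z) : Real.log (1 + z) ≤ z / √(1 + z) := by
  have h1 : 0 < 1 + z := by linarith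
  have hs : 0 < √(1 + z) := Real.sqrt_pos.2 h1
  have h2 := Real.self_le_sinh_iff.2
    (div_nonneg (Real.log_nonneg (by linarith : (1 : ℝ) ≤ 1 + z)) zero_le_two)
  rw [← Real.log_sqrt h1.le, Real.sinh_eq, Real.exp_neg, Real.exp_log hs, Real.log_sqrt h1.le] at h2
  have h3 : √(1 + z) - (√(1 + z))⁻¹ = z / √(1 + z) := by
    field_simp
    rw [Real.sq_sqrt h1.le]; ring
  linarith

lemma log_one_add_mul_le {z w : ℝ} (hw : 0 ≤ w) (hwz : w < z) :
    Real.log (1 + z) * (1 - w / z) ≤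
      6 / 5 * (1 + z / 4) * Real.log ((1 + z) / (1 + w)) := by
  have hz : 0 < z := hw.trans_lt hwz
  have h1 : 0 < 1 + z := by linarith
  have hs : 0 < √(1 + z) := Real.sqrt_pos.2 h1
  have hsq : √(1 + z) ^ 2 = 1 + z := Real.sq_sqrt h1.le
  have h2 : √(1 + z) ≤ 6 / 5 * (1 + z / 4) := by nlinarith [sq_nonneg (√(1 + z) - 5 / 3)]
  have h3 : (z - w) / (1 + z) ≤ Real.log ((1 + z) / (1 + w)) := by
    refine le_trans (le_of_eq ?_) (Real.one_sub_inv_le_log_of_pos (by positivity))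
    field_simp; ring
  have h4 : Real.log (1 + z) * (1 - w / z) ≤ z / √(1 + z) * (1 - w / z) :=
    mul_le_mul_of_nonneg_right (log_one_add_le_div_sqrt hz.le)
      (sub_nonneg.2 ((div_le_one hz).2 hwz.le))
  calc Real.log (1 + z) * (1 - w / z) ≤ z / √(1 + z) * (1 - w / z) := h4
    _ = √(1 + z) * ((z - w) / (1 + z)) := by
        have h5 : z / √(1 + z) = √(1 + z) * z / (1 + z) := by
          rw [div_eq_div_iff hs.ne' h1.ne']
          linear_combination (-z) * hsq
        rw [h5]; field_simp
    _ ≤ 6 / 5 * (1 + z / 4) * ((z - w) / (1 + z)) := by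
        have : 0 ≤ (z - w) / (1 + z) := div_nonneg (by linarith) h1.le
        gcongr
    _ ≤ _ := by gcongr

lemma log_ratio_pos {a b : ℝ} (hb : 0 ≤ b) (hab : b < a) :
    0 < Real.log ((1 + a) / (1 + b)) :=
  Real.log_pos ((one_lt_div (by linarith)).2 (by linarith))

lemma log_ratio_le_log_ratio_four {a b : ℝ} (hb : 0 ≤ b) (hab : b < a) :
    Real.log ((1 + a) / (1 + b)) ≤ Real.log ((1 + 4 * a) / (1 + 4 * b)) := by
  have ha : 0 < a := hb.trans_lt hab
  refine Real.log_le_log (by positivity) ?_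
  rw [div_le_div_iff₀ (by positivity) (by positivity)]
  nlinarith

lemma log_ratio_four_le {a b : ℝ} (hb : 0 ≤ b) (hab : b < a) :
    Real.log ((1 + 4 * a) / (1 + 4 * b)) ≤ 4 * Real.log ((1 + a) / (1 + b)) := by
  have ha : 0 < a := hb.trans_lt hab
  rw [show (4 : ℝ) = (4 : ℕ) by norm_num, ← Real.log_pow]
  refine Real.log_le_log (by positivity) ?_
  have h1 : (1 + a) / (1 + b) = 1 + (a - b) / (1 + b) := by field_simp; ring
  have h2 : 0 ≤ (a - b) / (1 + b) := div_nonneg (by linarith) (by linarith)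
  rw [h1]
  refine le_trans ?_ (one_add_mul_le_pow (by linarith) 4)
  have h3 : (1 + (4 : ℕ) * a) / (1 + (4 : ℕ) * b) = 1 + 4 * ((a - b) / (1 + 4 * b)) := by
    push_cast; field_simp; ring
  rw [h3]
  push_cast
  have : (a - b) / (1 + 4 * b) ≤ (a - b) / (1 + b) :=
    div_le_div_of_nonneg_left (by linarith) (by linarith) (by linarith)
  linarith

/-- The slower mode has decayed by the factor `κ` after the time `ln(1/κ) / ln((1+4a)/(1+4b))`. -/
lemma pow_le_mul_pow_of_time_le {a b κ : ℝ} (hb : 0 ≤ b) (hab : b < a) (hκ : 0 < κ) {t : ℕ}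
    (ht : Real.log (1 / κ) / Real.log ((1 + 4 * a) / (1 + 4 * b)) ≤ t) :
    (1 + 4 * b) ^ t ≤ κ * (1 + 4 * a) ^ t := by
  have hD := log_ratio_pos (a := 4 * a) (b := 4 * b) (by linarith) (by linarith)
  rw [div_le_iff₀ hD, ← Real.log_pow] at ht
  have ha : 0 < a := hb.trans_lt hab
  have h1 := (Real.log_le_log_iff (by positivity) (by positivity)).1 ht
  rw [div_pow, div_le_div_iff₀ hκ (by positivity)] at h1
  linarith

/-- The growth of the fast mode until the time `(5/4) ln(1/κ) / ln((1+4a)/(1+4b)) + 1`. -/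
lemma sq_pow_le_of_le_time {a b κ X : ℝ} (hb : 0 ≤ b) (hab : b < a) (hκ : 0 < κ) (hκ1 : κ < 1)
    (hX : (1 + a) / (1 - b / a) ≤ X) {t : ℕ}
    (ht : (t : ℝ) ≤ 5 / 4 * (Real.log (1 / κ) / Real.log ((1 + 4 * a) / (1 + 4 * b))) + 1) :
    ((1 + 4 * a) ^ t) ^ 2 * κ ^ (3 * X) ≤ (1 + 4 * a) ^ 2 := by
  have ha : 0 < a := hb.trans_lt hab
  have hD := log_ratio_pos (a := 4 * a) (b := 4 * b) (by linarith) (by linarith)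
  have hk : 0 < Real.log (1 / κ) := Real.log_pos (by rw [one_lt_div hκ]; exact hκ1)
  have hq : 0 < 1 - b / a := sub_pos.2 ((div_lt_one ha).2 hab)
  have h1 := log_one_add_mul_le (z := 4 * a) (w := 4 * b) (by linarith) (by linarith)
  rw [mul_div_mul_left _ _ four_ne_zero, mul_div_cancel_left₀ _ four_ne_zero] at h1
  have hα : 0 ≤ Real.log (1 + 4 * a) := Real.log_nonneg (by linarith)
  set D := Real.log ((1 + 4 * a) / (1 + 4 * b)) with hDdef
  have h2 : Real.log (1 + 4 * a) / D ≤ 6 / 5 * X := by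
    rw [div_le_iff₀ hD]
    have h3 : Real.log (1 + 4 * a) ≤ 6 / 5 * ((1 + a) / (1 - b / a)) * D := by
      rw [← le_div_iff₀ hq] at h1
      exact h1.trans_eq (by ring)
    exact h3.trans (by gcongr)
  have h4 : t * Real.log (1 + 4 * a) ≤
      Real.log (1 + 4 * a) + 3 / 2 * X * Real.log (1 / κ) := by
    calc t * Real.log (1 + 4 * a)
        ≤ (5 / 4 * (Real.log (1 / κ) / D) + 1) * Real.log (1 + 4 * a) := by gcongr
      _ = Real.log (1 + 4 * a) + 5 / 4 * Real.log (1 / κ) * (Real.log (1 + 4 * a) / D) := by ring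
      _ ≤ Real.log (1 + 4 * a) + 5 / 4 * Real.log (1 / κ) * (6 / 5 * X) := by gcongr
      _ = _ := by ring
  have hpos : 0 < 1 + 4 * a := by linarith
  rw [← Real.log_le_log_iff (by positivity) (by positivity),
    Real.log_mul (by positivity) (by positivity), Real.log_pow, Real.log_pow, Real.log_pow,
    Real.log_rpow hκ]
  rw [one_div, Real.log_inv] at h4
  push_cast
  linarith

lemma le_four_rpow (x : ℝ) : x ≤ (4 : ℝ) ^ x := by
  rcases lt_or_ge x 0 with hx | hx
  · exact hx.le.trans (by positivity)
  have h4 : 1 ≤ Real.log 4 := by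
    rw [Real.le_log_iff_exp_le (by norm_num)]
    linarith [Real.exp_one_lt_d9]
  rw [Real.rpow_def_of_pos (by norm_num)]
  nlinarith [Real.add_one_le_exp (Real.log 4 * x)]

/-- The admissible fraction of the reference initialization scale. -/
def initFactor (l : ℕ) (Λ : ℝ) : ℝ := 1 / (2 ^ (l + 2) * (1 + Λ) ^ l)

lemma initFactor_pos (l : ℕ) {Λ : ℝ} (hΛ : 0 < Λ) : 0 < initFactor l Λ := by
  unfold initFactor; positivity

variable {l n m r : ℕ} {A : Fin m → Matrix (Fin n) (Fin n) ℝ} {Z : Matrix (Fin n) (Fin r) ℝ}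

lemma epsScale_sq_le {L η κ : ℝ} (hL : 0 < L) (hκ : 0 < κ) (hn : 1 ≤ n) (hr : 1 ≤ r)
    (hσ : 0 ≤ sigma1 A Z) :
    epsScale l A Z L η κ ^ 2 ≤ κ / 2 * ((sigma1 A Z * ((matU A Z).rank : ℝ)) ^ l /
      (16 * L ^ ((l : ℝ) / 2))) * (κ / 4) ^ (3 * Xi l A Z η) := by
  have hsr : 0 ≤ sigma1 A Z * ((matU A Z).rank : ℝ) := by positivity
  have hn' : (1 : ℝ) ≤ n := by exact_mod_cast hn
  have hr' : (1 : ℝ) ≤ r := by exact_mod_cast hr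
  have hbase : L ≤ (r : ℝ) ^ 2 * n * L := by
    have : (1 : ℝ) ≤ (r : ℝ) ^ 2 * n := one_le_mul_of_one_le_of_one_le (one_le_pow₀ hr') hn'
    nlinarith
  have hsq : ∀ x y : ℝ, 0 ≤ x → (x ^ y) ^ 2 = x ^ (2 * y) := fun x y hx => by
    rw [mul_comm, Real.rpow_mul hx, Real.rpow_two]
  rw [epsScale, mul_pow, mul_pow, Real.sq_sqrt (by positivity), div_pow, mul_pow,
    hsq _ _ hsr, hsq _ _ (by positivity), hsq _ _ (by positivity),
    show 2 * ((l : ℝ) / 2) = l by ring, Real.rpow_natCast,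
    show 2 * (3 * Xi l A Z η / 2) = 3 * Xi l A Z η by ring,
    show 2 * ((l : ℝ) / 4) = (l : ℝ) / 2 by ring, show (4 : ℝ) ^ 2 = 16 by norm_num]
  gcongr

lemma rank_pow_le_Xi {η : ℝ} (hη : 0 < η) (hl : 1 ≤ l) (h : sigma2 A Z < sigma1 A Z) :
    (1 + η * sigma1 A Z ^ l) / (1 - η * sigma2 A Z ^ l / (η * sigma1 A Z ^ l)) ≤ Xi l A Z η ∧
    ((matU A Z).rank : ℝ) ^ l ≤ Xi l A Z η ∧ 1 + 4 * (η * sigma1 A Z ^ l) ≤ 4 * Xi l A Z η := by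
  have hσ2 := sigma2_nonneg A Z
  have hσ1 : 0 < sigma1 A Z := hσ2.trans_lt h
  have hrk : (1 : ℝ) ≤ ((matU A Z).rank : ℝ) ^ l :=
    one_le_pow₀ (by exact_mod_cast one_le_rank_matU h)
  have hq : (sigma2 A Z / sigma1 A Z) ^ l < 1 :=
    pow_lt_one₀ (by positivity) ((div_lt_one hσ1).2 h) (by omega)
  have hq0 : 0 ≤ (sigma2 A Z / sigma1 A Z) ^ l := by positivity
  rw [mul_div_mul_left _ _ hη.ne', ← div_pow, Xi]
  set q := (sigma2 A Z / sigma1 A Z) ^ l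
  set R := ((matU A Z).rank : ℝ) ^ l
  set s := η * sigma1 A Z ^ l with hs
  have hs0 : 0 < s := by positivity
  have hq1 : 0 < 1 - q := by linarith
  refine ⟨?_, ?_, ?_⟩
  · gcongr
    exact le_mul_of_one_le_left (by positivity) hrk
  · rw [le_div_iff₀ hq1]
    nlinarith
  · rw [← mul_div_assoc, le_div_iff₀ hq1]
    nlinarith

/-- The size of the cubic correction at the time `t` relative to the linearized dynamics. -/
lemma correction_le {L Λ η κ ε : ℝ} (hl : 1 ≤ l) (hL : 0 < L) (hLΛ : L ≤ Λ) (hη : 0 < η)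
    (hκ : 0 < κ) (hκ1 : κ < 1) (h : sigma2 A Z < sigma1 A Z) (hε : 0 < ε)
    (hε' : ε ≤ initFactor l Λ * epsScale l A Z L η κ) {t : ℕ}
    (ht : (t : ℝ) ≤ 5 / 4 * (Real.log (1 / κ) / Real.log ((1 + 4 * (η * sigma1 A Z ^ l)) /
      (1 + 4 * (η * sigma2 A Z ^ l)))) + 1) :
    4 * L ^ l / sigma1 A Z ^ l * (ε * (1 + 4 * (η * sigma1 A Z ^ l)) ^ t) ^ 2 ≤
      κ / 4 ^ (l + 1) := by
  have hσ2 := sigma2_nonneg A Z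
  have hσ1 : 0 < sigma1 A Z := hσ2.trans_lt h
  obtain ⟨hn, hr⟩ := one_le_dims h
  obtain ⟨hX1, hX2, hX3⟩ := rank_pow_le_Xi hη hl h
  have hΛ : 0 < Λ := hL.trans_le hLΛ
  have hlt : η * sigma2 A Z ^ l < η * sigma1 A Z ^ l :=
    mul_lt_mul_of_pos_left (pow_lt_pow_left₀ h hσ2 (by omega)) hη
  have hgrow := sq_pow_le_of_le_time (by positivity) hlt hκ hκ1 hX1 ht
  have hes := epsScale_sq_le (l := l) (η := η) hL hκ hn hr hσ1.le
  set X := Xi l A Z η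
  set α := 1 + 4 * (η * sigma1 A Z ^ l) with hα
  have hα0 : 0 < α := by positivity
  set ρ := ((matU A Z).rank : ℝ)
  set σ := sigma1 A Z
  set H := L ^ ((l : ℝ) / 2) with hH
  have hH0 : 0 < H := by positivity
  have hHH : L ^ l = H * H := by
    rw [hH, ← Real.rpow_add hL, add_halves, Real.rpow_natCast]
  have hHΛ : H ≤ (1 + Λ) ^ l := by
    refine le_of_sq_le_sq ?_ (by positivity)
    rw [sq, ← hHH, ← pow_mul, mul_comm, pow_mul]
    exact pow_le_pow_left₀ hL.le (by nlinarith) l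
  have hε2 : ε ^ 2 ≤ initFactor l Λ ^ 2 *
      (κ / 2 * ((σ * ρ) ^ l / (16 * H)) * (κ / 4) ^ (3 * X)) := by
    refine (pow_le_pow_left₀ hε.le hε' 2).trans ?_
    rw [mul_pow]
    gcongr
  have hsplit : (κ / 4) ^ (3 * X) = κ ^ (3 * X) / ((4 : ℝ) ^ X) ^ 3 := by
    rw [Real.div_rpow hκ.le (by norm_num), mul_comm 3 X, Real.rpow_mul (by norm_num : (0 : ℝ) ≤ 4)]
    norm_cast
  have hXpos : 0 < X := by linarith
  have h4X : X ^ 3 ≤ ((4 : ℝ) ^ X) ^ 3 := pow_le_pow_left₀ hXpos.le (le_four_rpow X) 3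
  have hρα : ρ ^ l * α ^ 2 ≤ 16 * ((4 : ℝ) ^ X) ^ 3 := by
    calc ρ ^ l * α ^ 2 ≤ X * (4 * X) ^ 2 := by gcongr
      _ = 16 * X ^ 3 := by ring
      _ ≤ _ := by gcongr
  have hF : 0 < ((4 : ℝ) ^ X) ^ 3 := by positivity
  set F := ((4 : ℝ) ^ X) ^ 3
  set a := initFactor l Λ with ha
  have ha0 : 0 < a := initFactor_pos l hΛ
  calc 4 * L ^ l / σ ^ l * (ε * α ^ t) ^ 2
      = 4 * (H * H) / σ ^ l * (ε ^ 2 * (α ^ t) ^ 2) := by rw [hHH, mul_pow]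
    _ ≤ 4 * (H * H) / σ ^ l * (a ^ 2 *
        (κ / 2 * ((σ * ρ) ^ l / (16 * H)) * (κ / 4) ^ (3 * X)) * (α ^ t) ^ 2) := by gcongr
    _ = a ^ 2 * (κ / 8) * H * ρ ^ l / F * ((α ^ t) ^ 2 * κ ^ (3 * X)) := by
        rw [hsplit, mul_pow]; field_simp; ring
    _ ≤ a ^ 2 * (κ / 8) * H * ρ ^ l / F * α ^ 2 := by gcongr
    _ = a ^ 2 * (κ / 8) * H / F * (ρ ^ l * α ^ 2) := by ring
    _ ≤ a ^ 2 * (κ / 8) * H / F * (16 * F) := by gcongr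
    _ = 2 * κ * a ^ 2 * H := by field_simp; ring
    _ ≤ 2 * κ * a ^ 2 * (1 + Λ) ^ l := by gcongr
    _ = 2 * κ * (1 / 4 ^ (l + 2)) / (1 + Λ) ^ l := by
        rw [ha, initFactor, show (4 : ℝ) = 2 ^ 2 by norm_num, ← pow_mul]
        field_simp
        ring
    _ ≤ 2 * κ * (1 / 4 ^ (l + 2)) / 1 := by
        gcongr
        exact one_le_pow₀ (by linarith)
    _ ≤ κ / 4 ^ (l + 1) := by
        rw [pow_succ 4 (l + 1)]
        have : 0 < (4 : ℝ) ^ (l + 1) := by positivity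
        rw [div_one, le_div_iff₀ this]
        field_simp
        norm_num

end Scalars

section Gaussian

lemma absolutelyContinuous_pi_fin {n : ℕ} {μ ν : Measure ℝ} [SigmaFinite μ] [SigmaFinite ν]
    (h : μ ≪ ν) :
    (Measure.pi fun _ : Fin n => μ) ≪ Measure.pi fun _ : Fin n => ν := by
  induction n with
  | zero => rw [Measure.pi_of_empty, Measure.pi_of_empty]
  | succ n ih =>
    rw [← (measurePreserving_piFinSuccAbove (fun _ : Fin (n + 1) => μ) 0).symm.map_eq,
      ← (measurePreserving_piFinSuccAbove (fun _ : Fin (n + 1) => ν) 0).symm.map_eq]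
    exact (h.prod ih).map (MeasurableEquiv.measurable _)

lemma absolutelyContinuous_pi {ι : Type} [Fintype ι] {μ ν : Measure ℝ} [SigmaFinite μ]
    [SigmaFinite ν] (h : μ ≪ ν) :
    (Measure.pi fun _ : ι => μ) ≪ Measure.pi fun _ : ι => ν := by
  let e := (Fintype.equivFin ι).symm
  rw [← (measurePreserving_piCongrLeft (fun _ : ι => μ) e).map_eq,
    ← (measurePreserving_piCongrLeft (fun _ : ι => ν) e).map_eq]
  exact (absolutelyContinuous_pi_fin h).map (MeasurableEquiv.measurable _)

variable {ι : Type} [Fintype ι]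

lemma isoGaussian_absolutelyContinuous {ρ : ℝ≥0} (hρ : ρ ≠ 0) : isoGaussian ι ρ ≪ volume := by
  rw [isoGaussian, ← (PiLp.volume_preserving_toLp ι).map_eq]
  exact (absolutelyContinuous_pi (gaussianReal_absolutelyContinuous 0 hρ)).map
    (PiLp.volume_preserving_toLp ι).measurable

instance isProbabilityMeasure_isoGaussian (ρ : ℝ≥0) : IsProbabilityMeasure (isoGaussian ι ρ) :=
  Measure.isProbabilityMeasure_map (PiLp.volume_preserving_toLp ι).measurable.aemeasurable

lemma integral_exp_sq_gaussianReal {ρ : ℝ≥0} (hρ : 0 < ρ) :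
    ∫ x, Real.exp (x ^ 2 / (4 * ρ)) ∂gaussianReal 0 ρ = √2 := by
  have hρ' : (0 : ℝ) < ρ := hρ
  rw [integral_gaussianReal_eq_integral_smul hρ.ne']
  have : ∀ x : ℝ, gaussianPDFReal 0 ρ x • Real.exp (x ^ 2 / (4 * ρ)) =
      (√(2 * Real.pi * ρ))⁻¹ * Real.exp (-(1 / (4 * ρ)) * x ^ 2) := by
    intro x
    rw [gaussianPDFReal, smul_eq_mul, mul_assoc, ← Real.exp_add]
    congr 2
    field_simp
    ring
  simp only [this]
  rw [integral_const_mul, integral_gaussian, ← Real.sqrt_inv, ← Real.sqrt_mul (by positivity)]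
  congr 1
  have := Real.pi_pos
  field_simp
  norm_num

lemma isoGaussian_norm_ge_le {ρ : ℝ≥0} (hρ : 0 < ρ) :
    (isoGaussian ι ρ).real {g | 1 / 4 ≤ ‖g‖} ≤
      √2 ^ Fintype.card ι * Real.exp (-(1 / 64) / ρ) := by
  have hρ' : (0 : ℝ) < ρ := hρ
  set f : (ι → ℝ) → ℝ := fun x => ∏ i, Real.exp (x i ^ 2 / (4 * ρ)) with hf
  have hint : ∫ x, f x ∂(Measure.pi fun _ : ι => gaussianReal 0 ρ) = √2 ^ Fintype.card ι := by
    rw [hf, integral_fintype_prod_eq_prod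
      (f := fun (_ : ι) (y : ℝ) => Real.exp (y ^ 2 / (4 * ρ)))]
    simp [integral_exp_sq_gaussianReal hρ]
  have hintegrable : Integrable f (Measure.pi fun _ : ι => gaussianReal 0 ρ) := by
    by_contra h
    rw [integral_undef h] at hint
    have : (0 : ℝ) < √2 ^ Fintype.card ι := by positivity
    linarith
  have hmarkov := mul_meas_ge_le_integral_of_nonneg
    (ae_of_all _ fun x => Finset.prod_nonneg fun i _ => (Real.exp_pos _).le) hintegrable
    (Real.exp (1 / 64 / ρ))
  rw [hint] at hmarkov
  have hmeas : MeasurableSet {g : EuclideanSpace ℝ ι | 1 / 4 ≤ ‖g‖} :=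
    measurableSet_le measurable_const measurable_norm
  have hset : (WithLp.toLp 2 : (ι → ℝ) → EuclideanSpace ℝ ι) ⁻¹' {g | 1 / 4 ≤ ‖g‖} ⊆
      {x | Real.exp (1 / 64 / ρ) ≤ f x} := by
    intro x hx
    have hx' : 1 / 4 ≤ ‖(WithLp.toLp 2 x : EuclideanSpace ℝ ι)‖ := hx
    have h2 : (1 / 4) ^ 2 ≤ ∑ i, x i ^ 2 := by
      have := pow_le_pow_left₀ (by norm_num) hx' 2
      rwa [EuclideanSpace.real_norm_sq_eq] at this
    change Real.exp (1 / 64 / ρ) ≤ ∏ i, Real.exp (x i ^ 2 / (4 * ρ))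
    rw [← Real.exp_sum, ← Finset.sum_div, Real.exp_le_exp,
      div_le_div_iff₀ hρ' (by positivity)]
    nlinarith
  have hle : (isoGaussian ι ρ).real {g | 1 / 4 ≤ ‖g‖} ≤
      (Measure.pi fun _ : ι => gaussianReal 0 ρ).real {x | Real.exp (1 / 64 / ρ) ≤ f x} := by
    rw [isoGaussian, map_measureReal_apply (PiLp.volume_preserving_toLp ι).measurable hmeas]
    exact measureReal_mono hset
  rw [neg_div, Real.exp_neg, ← div_eq_mul_inv, le_div_iff₀ (Real.exp_pos _), mul_comm]
  exact (mul_le_mul_of_nonneg_left hle (Real.exp_pos _).le).trans hmarkov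

lemma sqrt_two_pow_mul_exp_le {d : ℕ} {ρ : ℝ≥0} (hρ : 0 < ρ) (hρd : ρ ≤ 1 / (64 * (d + 1))) :
    √2 ^ d * Real.exp (-(1 / 64) / ρ) ≤ Real.exp (-(1 / 128) / ρ) := by
  have hρ' : (0 : ℝ) < ρ := hρ
  have h1 : (ρ : ℝ) * (64 * (d + 1)) ≤ 1 := by
    have : (ρ : ℝ) ≤ 1 / (64 * (d + 1)) := by exact_mod_cast hρd
    rwa [le_div_iff₀ (by positivity)] at this
  have h2 : √2 ≤ Real.exp (1 / 2) := by
    rw [Real.sqrt_le_left (Real.exp_pos _).le, ← Real.exp_nat_mul]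
    have := Real.add_one_le_exp (1 : ℝ)
    norm_num at this ⊢
    linarith
  calc √2 ^ d * Real.exp (-(1 / 64) / ρ)
      ≤ Real.exp (1 / 2) ^ d * Real.exp (-(1 / 64) / ρ) := by gcongr
    _ = Real.exp (d * (1 / 2) + -(1 / 64) / ρ) := by rw [← Real.exp_nat_mul, ← Real.exp_add]
    _ ≤ _ := by
      rw [Real.exp_le_exp, ← sub_nonneg]
      have : -(1 / 128) / (ρ : ℝ) - (d * (1 / 2) + -(1 / 64) / ρ) =
          (1 - 64 * d * ρ) / (128 * ρ) := by field_simp; ring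
      rw [this]
      refine div_nonneg ?_ (by positivity)
      nlinarith

/-- An event containing a ball of radius `1/4` has high probability. -/
lemma one_sub_le_isoGaussian {ρ : ℝ≥0} (hρ : 0 < ρ)
    (hρd : ρ ≤ 1 / (64 * (Fintype.card ι + 1))) {S : Set (EuclideanSpace ℝ ι)}
    (hS : ∀ g, ‖g‖ < 1 / 4 → g ∈ S) :
    1 - ENNReal.ofReal (2 * Real.exp (-(1 / 128) / ρ)) ≤ isoGaussian ι ρ S := by
  have hmeas : MeasurableSet {g : EuclideanSpace ℝ ι | 1 / 4 ≤ ‖g‖} :=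
    measurableSet_le measurable_const measurable_norm
  have h1 : isoGaussian ι ρ {g | 1 / 4 ≤ ‖g‖} ≤
      ENNReal.ofReal (2 * Real.exp (-(1 / 128) / ρ)) := by
    rw [← ofReal_measureReal]
    refine ENNReal.ofReal_le_ofReal ?_
    have := (isoGaussian_norm_ge_le (ι := ι) hρ).trans (sqrt_two_pow_mul_exp_le hρ hρd)
    linarith [Real.exp_pos (-(1 / 128) / (ρ : ℝ))]
  calc _ ≤ 1 - isoGaussian ι ρ {g | 1 / 4 ≤ ‖g‖} := tsub_le_tsub_left h1 1
    _ = isoGaussian ι ρ {g | 1 / 4 ≤ ‖g‖}ᶜ := (prob_compl_eq_one_sub hmeas).symm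
    _ ≤ _ := measure_mono fun g hg => hS g (not_le.1 hg)

end Gaussian

section GenericNonvanishing

lemma volume_zeros_eq_zero {F : ℝ → ℝ} (hF : AnalyticOnNhd ℝ F Set.univ) {x : ℝ} (hx : F x ≠ 0) :
    volume {s | F s = 0} = 0 := by
  have h1 := hF.preimage_zero_mem_codiscrete hx
  have h2 := ae_restrict_le_codiscreteWithin (μ := (volume : Measure ℝ)) MeasurableSet.univ h1
  rw [Measure.restrict_univ, mem_ae_iff] at h2
  exact measure_mono_null (fun s (hs : F s = 0) => by simpa using hs) h2

/-- A continuous function vanishes almost nowhere if its restrictions to almost all lines through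
the origin are products of a power and a nonzero analytic function. -/
lemma addHaar_zeros_eq_zero {E : Type} [NormedAddCommGroup E] [InnerProductSpace ℝ E]
    [FiniteDimensional ℝ E] [MeasurableSpace E] [BorelSpace E] (μ : Measure E)
    [μ.IsAddHaarMeasure] {f : E → ℝ} (hf : Continuous f) (l : ℕ)
    (h : ∀ᵐ x ∂μ, ∃ F : ℝ → ℝ, AnalyticOnNhd ℝ F Set.univ ∧ F 0 ≠ 0 ∧
      ∀ s, f (s • x) = s ^ l * F s) : μ {x | f x = 0} = 0 := by
  have hcont : Continuous fun p : E × ℝ => f (p.2 • p.1) :=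
    hf.comp (continuous_snd.smul continuous_fst)
  have hS : MeasurableSet {p : E × ℝ | f (p.2 • p.1) = 0} :=
    hcont.measurable (measurableSet_singleton 0)
  have hprod : (μ.prod volume) {p : E × ℝ | f (p.2 • p.1) = 0} = 0 := by
    rw [Measure.measure_prod_null hS]
    filter_upwards [h] with x ⟨F, hF, hF0, hfF⟩
    refine measure_mono_null (t := {0} ∪ {s | F s = 0}) (fun s hs => ?_)
      (measure_union_null (by simp) (volume_zeros_eq_zero hF hF0))
    have hs' : f (s • x) = 0 := hs
    rw [hfF] at hs'
    rcases mul_eq_zero.1 hs' with h0 | h0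
    · exact Or.inl (eq_zero_of_pow_eq_zero h0)
    · exact Or.inr h0
  rw [← Measure.prod_swap, Measure.map_apply measurable_swap hS] at hprod
  have hslice := Measure.measure_ae_null_of_prod_null hprod
  have hne : ∀ᵐ s : ℝ ∂volume, s ≠ 0 := by
    rw [ae_iff]; simp
  obtain ⟨s, hs, hs0⟩ := (hslice.and hne).exists
  have hpre : μ ((s • ·) ⁻¹' {x | f x = 0}) = 0 := hs
  rw [Measure.addHaar_preimage_smul μ hs0, mul_eq_zero] at hpre
  refine hpre.resolve_left ?_
  rw [ENNReal.ofReal_eq_zero, not_le]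
  positivity

variable {l n m r : ℕ} {A : Fin m → Matrix (Fin n) (Fin n) ℝ} {Z : Matrix (Fin n) (Fin r) ℝ}

lemma cubic_smul (c : ℝ) (w : Tensor l (Fin n × Fin r)) :
    cubic A (c • w) (c • w) (c • w) = c ^ 3 • cubic A w w w := by
  simp only [cubic, map_smul, real_inner_smul_left, real_inner_smul_right, smul_smul,
    Finset.smul_sum]
  refine Finset.sum_congr rfl fun k _ => ?_
  congr 1
  ring

lemma contDiff_cubic {E : Type} [NormedAddCommGroup E] [NormedSpace ℝ E] {k : WithTop ℕ∞}
    {q : E → Tensor l (Fin n × Fin r)} (hq : ContDiff ℝ k q) :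
    ContDiff ℝ k fun s => cubic A (q s) (q s) (q s) := by
  have hT : ∀ k' : Fin l → Fin m, ContDiff ℝ k fun s => liftOp A k' (q s) := fun k' =>
    (LinearMap.toContinuousLinearMap (liftOp (r := r) A k')).contDiff.comp hq
  exact ContDiff.sum fun k' _ => (hq.inner ℝ (hT k')).smul (hT k')

lemma contDiff_gd (hA : ∀ k, (A k).IsSymm) (η ε : ℝ) (t : ℕ) {k : WithTop ℕ∞} :
    ContDiff ℝ k fun x => gd l A Z η ε x t := by
  induction t with
  | zero =>
    have h : ContDiff ℝ k (rankOne l : EuclideanSpace ℝ (Fin n × Fin r) → _) := by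
      refine contDiff_piLp' 2 fun i => ?_
      simp only [rankOne_apply]
      exact contDiff_prod fun p _ => contDiff_piLp_apply (i := i p) 2
    exact h.const_smul ε
  | succ t ih =>
    simp only [gd_succ hA]
    exact (ih.add (((LinearMap.toContinuousLinearMap (liftU l A Z)).contDiff.comp ih).const_smul
      _)).sub ((contDiff_cubic ih).const_smul _)

/-- The gradient descent trajectory along a ray, divided by the `l`-th power of the parameter. -/
def rayGd (l : ℕ) (A : Fin m → Matrix (Fin n) (Fin n) ℝ) (Z : Matrix (Fin n) (Fin r) ℝ)
    (η ε : ℝ) (x : EuclideanSpace ℝ (Fin n × Fin r)) :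
    ℕ → ℝ → Tensor l (Fin n × Fin r)
  | 0, _ => ε • rankOne l x
  | t + 1, s => rayGd l A Z η ε x t s + (4 * η) • liftU l A Z (rayGd l A Z η ε x t s) -
      (4 * η * s ^ (2 * l)) •
        cubic A (rayGd l A Z η ε x t s) (rayGd l A Z η ε x t s) (rayGd l A Z η ε x t s)

lemma gd_smul (hA : ∀ k, (A k).IsSymm) (η ε : ℝ) (x : EuclideanSpace ℝ (Fin n × Fin r)) (t : ℕ)
    (s : ℝ) : gd l A Z η ε (s • x) t = s ^ l • rayGd l A Z η ε x t s := by
  induction t with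
  | zero => rw [gd, rayGd, rankOne_smul, smul_comm]
  | succ t ih =>
    rw [gd_succ hA, ih, rayGd, cubic_smul, map_smul]
    simp only [smul_sub, smul_add, smul_smul]
    congr 2
    · rw [mul_comm]
    · ring

lemma rayGd_zero (hl : 1 ≤ l) (η ε : ℝ) (x : EuclideanSpace ℝ (Fin n × Fin r)) (t : ℕ) :
    rayGd l A Z η ε x t 0 = ε • lin l A Z η t x := by
  induction t with
  | zero => rfl
  | succ t ih =>
    rw [rayGd, ih, lin_succ, zero_pow (by omega), mul_zero, zero_smul, sub_zero, map_smul]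
    module

lemma contDiff_rayGd (η ε : ℝ) (x : EuclideanSpace ℝ (Fin n × Fin r)) (t : ℕ)
    {k : WithTop ℕ∞} : ContDiff ℝ k (rayGd l A Z η ε x t) := by
  induction t with
  | zero => exact contDiff_const
  | succ t ih =>
    exact (ih.add (((LinearMap.toContinuousLinearMap (liftU l A Z)).contDiff.comp ih).const_smul
      _)).sub ((contDiff_const.mul (contDiff_id.pow _)).smul (contDiff_cubic ih))

lemma volume_inner_gd_eq_zero (hA : ∀ k, (A k).IsSymm) (hl : 1 ≤ l) {η ε μ : ℝ} (hη : 0 < η)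
    (hε : ε ≠ 0) (hμ : 0 < μ) {e : EuclideanSpace ℝ (Fin n × Fin r)} (he : ‖e‖ = 1)
    (hU : Matrix.toEuclideanLin (matU A Z) e = μ • e) (t : ℕ) :
    volume {x | ⟪gd l A Z η ε x t, rankOne l e⟫ = 0} = 0 := by
  refine addHaar_zeros_eq_zero volume
    ((contDiff_gd hA η ε t (k := 0)).continuous.inner continuous_const) l ?_
  have hker : (LinearMap.ker (innerₛₗ ℝ e)) ≠ ⊤ := by
    intro htop
    have : e ∈ LinearMap.ker (innerₛₗ ℝ e) := htop ▸ Submodule.mem_top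
    simp [he] at this
  have hae := measure_eq_zero_iff_ae_notMem.1 (Measure.addHaar_submodule volume _ hker)
  filter_upwards [hae] with x hx
  refine ⟨fun s => ⟪rayGd l A Z η ε x t s, rankOne l e⟫, ?_, ?_, fun s => ?_⟩
  · rw [← contDiff_omega_iff_analyticOnNhd]
    exact (contDiff_rayGd η ε x t).inner ℝ contDiff_const
  · have hx' : ⟪x, e⟫ ≠ 0 := by
      rw [real_inner_comm]
      simpa using hx
    beta_reduce
    rw [rayGd_zero hl, real_inner_smul_left, inner_lin_eigenvector hA hU]
    have : 0 < 1 + 4 * η * μ ^ l := by positivity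
    exact mul_ne_zero hε (mul_ne_zero (pow_ne_zero _ this.ne') (pow_ne_zero _ hx'))
  · rw [gd_smul hA, real_inner_smul_left]

end GenericNonvanishing

section Dynamics

variable {l n m r : ℕ} {A : Fin m → Matrix (Fin n) (Fin n) ℝ} {Z : Matrix (Fin n) (Fin r) ℝ}

lemma norm_projection_le {E : Type} [NormedAddCommGroup E] [InnerProductSpace ℝ E]
    {P : E →ₗ[ℝ] E} (hPs : ∀ x y, ⟪P x, y⟫ = ⟪x, P y⟫) (hPP : ∀ x, P (P x) = P x) (x : E) :
    ‖P x‖ ≤ ‖x‖ ∧ ‖x - P x‖ ≤ ‖x‖ := by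
  have h0 : ⟪P x, x - P x⟫ = 0 := by rw [hPs, map_sub, hPP, sub_self, inner_zero_right]
  have h1 : ‖x‖ ^ 2 = ‖P x‖ ^ 2 + ‖x - P x‖ ^ 2 := by
    have := norm_add_sq_real (P x) (x - P x)
    rw [add_sub_cancel, h0] at this
    linarith
  constructor <;> refine le_of_sq_le_sq ?_ (norm_nonneg _) <;> nlinarith [sq_nonneg ‖P x‖,
    sq_nonneg ‖x - P x‖]

/-- Lower and upper bounds for the two leading modes, after the cubic correction is controlled. -/
lemma mode_bounds {l : ℕ} (hl : 1 ≤ l) {G κ Q X Y S : ℝ} (hG : 0 < G) (hκ : 0 < κ) (hκ1 : κ < 1)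
    (hQ : Q * G ^ 2 ≤ κ / 4 ^ (l + 1)) (hX0 : 0 ≤ X) (hX : X ≤ 5 / 4)
    (hY : 3 / 4 ≤ Y) (hS0 : 0 ≤ S) (hS : S ≤ 1 / 4) (hQ0 : 0 ≤ Q) :
    Q * (G * X ^ l) ^ 2 ≤ 1 ∧ 0 < G * Y ^ l - Q * (G * X ^ l) ^ 3 ∧
      κ * G * S ^ l + Q * (G * X ^ l) ^ 3 ≤ κ * (G * Y ^ l - Q * (G * X ^ l) ^ 3) := by
  have h4 : (0 : ℝ) < 4 ^ l := by positivity
  have hX2 : (X ^ l) ^ 2 ≤ 2 ^ l := by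
    rw [← pow_mul, mul_comm, pow_mul]
    exact pow_le_pow_left₀ (by positivity) (by nlinarith) l
  have hX3 : (X ^ l) ^ 3 ≤ 2 ^ l := by
    rw [← pow_mul, mul_comm, pow_mul]
    refine pow_le_pow_left₀ (by positivity) ?_ l
    calc X ^ 3 ≤ (5 / 4) ^ 3 := pow_le_pow_left₀ hX0 hX 3
      _ ≤ 2 := by norm_num
  have h24 : (2 : ℝ) ^ l / 4 ^ l = (1 / 2) ^ l := by rw [← div_pow]; norm_num
  have hhalf : κ / 4 ^ (l + 1) * 2 ^ l = κ / 4 * (1 / 2) ^ l := by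
    rw [← h24, pow_succ]; field_simp
  have hhalf1 : (1 / 2 : ℝ) ^ l ≤ 1 := pow_le_one₀ (by norm_num) (by norm_num)
  have hhalf0 : (0 : ℝ) < (1 / 2) ^ l := by positivity
  have hδ : Q * (G * X ^ l) ^ 3 ≤ G * (κ / 4 * (1 / 2) ^ l) := by
    calc Q * (G * X ^ l) ^ 3 = G * (Q * G ^ 2 * (X ^ l) ^ 3) := by ring
      _ ≤ G * (κ / 4 ^ (l + 1) * 2 ^ l) := by gcongr
      _ = _ := by rw [hhalf]
  have hYl : (3 / 4 : ℝ) ^ l ≤ Y ^ l := pow_le_pow_left₀ (by norm_num) hY l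
  have hYh : (1 / 2 : ℝ) ^ l ≤ (3 / 4) ^ l := pow_le_pow_left₀ (by norm_num) (by norm_num) l
  have hSl : S ^ l ≤ 1 / 2 * (1 / 2) ^ l := by
    calc S ^ l ≤ (1 / 4) ^ l := pow_le_pow_left₀ hS0 hS l
      _ = (1 / 2) ^ l * (1 / 2) ^ l := by rw [← mul_pow]; norm_num
      _ ≤ 1 / 2 * (1 / 2) ^ l := by
        gcongr
        calc (1 / 2 : ℝ) ^ l ≤ (1 / 2) ^ 1 :=
              pow_le_pow_of_le_one (by norm_num) (by norm_num) hl
          _ = 1 / 2 := pow_one _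
  refine ⟨?_, ?_, ?_⟩
  · calc Q * (G * X ^ l) ^ 2 = Q * G ^ 2 * (X ^ l) ^ 2 := by ring
      _ ≤ κ / 4 ^ (l + 1) * 2 ^ l := by gcongr
      _ = κ / 4 * (1 / 2) ^ l := hhalf
      _ ≤ 1 := by nlinarith
  · have : G * (κ / 4 * (1 / 2) ^ l) < G * Y ^ l := by
      gcongr
      nlinarith
    linarith
  · have h1 : κ * (Q * (G * X ^ l) ^ 3) ≤ Q * (G * X ^ l) ^ 3 :=
      mul_le_of_le_one_left (by positivity) hκ1.le
    have h2 : κ * G * S ^ l + 2 * (G * (κ / 4 * (1 / 2) ^ l)) ≤ κ * (G * Y ^ l) := by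
      have : S ^ l + 1 / 2 * (1 / 2) ^ l ≤ Y ^ l := by linarith
      have := mul_le_mul_of_nonneg_left this (mul_pos hκ hG).le
      linarith
    linarith

lemma even_order_bounds {L η κ ε : ℝ} (hA : ∀ k, (A k).IsSymm) (hR : RSS A Z L) (hl : 1 ≤ l)
    (hle : Even l) (hη : 0 < η) (hκ : 0 < κ) (hκ1 : κ < 1) (h : sigma2 A Z < sigma1 A Z)
    {v₁ g : EuclideanSpace ℝ (Fin n × Fin r)} (hv : IsTopSingularVector A Z v₁)
    (hg : ‖g‖ < 1 / 4) (hε : 0 < ε) {t : ℕ}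
    (ht : Real.log (1 / κ) / Real.log ((1 + 4 * (η * sigma1 A Z ^ l)) /
      (1 + 4 * (η * sigma2 A Z ^ l))) ≤ t)
    (hcorr : 4 * L ^ l / sigma1 A Z ^ l * (ε * (1 + 4 * (η * sigma1 A Z ^ l)) ^ t) ^ 2 ≤
      κ / 4 ^ (l + 1)) :
    0 < vEig 1 (gd l A Z η ε (v₁ + g) t) ∧ 0 < vEigRankOne 1 (gd l A Z η ε (v₁ + g) t) ∧
      vEigRankOne 2 (gd l A Z η ε (v₁ + g) t) ≤
        κ * vEigRankOne 1 (gd l A Z η ε (v₁ + g) t) := by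
  obtain ⟨P, c, hc, hPs, hPP, hUP, hPU, hPσ, hPv⟩ := exists_topProjection hA h hv
  have hσ2 := sigma2_nonneg A Z
  have hσ1 : 0 < sigma1 A Z := hσ2.trans_lt h
  have hL := hR.pos h
  have hlt : η * sigma2 A Z ^ l < η * sigma1 A Z ^ l :=
    mul_lt_mul_of_pos_left (pow_lt_pow_left₀ h hσ2 (by omega)) hη
  have hdecay := pow_le_mul_pow_of_time_le (mul_nonneg hη.le (pow_nonneg hσ2 l)) hlt hκ ht
  obtain ⟨hPg, hQg⟩ := norm_projection_le hPs hPP g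
  set x₀ := v₁ + g with hx₀
  have hy : P x₀ = v₁ + P g := by rw [hx₀, map_add, hPv]
  have hz : x₀ - P x₀ = g - P g := by rw [hy, hx₀]; abel
  have hynorm : 3 / 4 ≤ ‖P x₀‖ := by
    have h1 := norm_sub_le (v₁ + P g) (P g)
    rw [add_sub_cancel_right, hv.1] at h1
    rw [hy]
    linarith
  have hxnorm : ‖x₀‖ ≤ 5 / 4 := by
    have h1 := norm_add_le v₁ g
    rw [hv.1] at h1
    linarith
  have hznorm : ‖x₀ - P x₀‖ ≤ 1 / 4 := by rw [hz]; linarith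
  set y := P x₀ with hydef
  have hypos : 0 < ‖y‖ := by linarith
  set w := gd l A Z η ε x₀ t with hw
  rw [← mul_assoc 4 η, ← mul_assoc 4 η] at hdecay
  rw [← mul_assoc 4 η] at hcorr
  set α := 1 + 4 * η * sigma1 A Z ^ l with hα
  have hα0 : 0 < α := by positivity
  obtain ⟨hone, hpos, hfin⟩ := mode_bounds hl (by positivity : 0 < ε * α ^ t) hκ hκ1 hcorr
    (norm_nonneg x₀) hxnorm hynorm (norm_nonneg _) hznorm (by positivity)
  have herr := atomBd_gd_sub_lin hA hR hL.le hη.le hε.le hσ1 norm_matU_le x₀ t hone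
  rw [← hw, ← hα] at herr
  set δ := 4 * L ^ l / sigma1 A Z ^ l * (ε * α ^ t * ‖x₀‖ ^ l) ^ 3 with hδ
  have hclose : ∀ v : EuclideanSpace ℝ (Fin n × Fin r), ‖v‖ = 1 →
      |⟪w, rankOne l v⟫ - ε * ⟪lin l A Z η t x₀, rankOne l v⟫| ≤ δ := by
    intro v hv1
    have := herr.abs_inner_le v
    rwa [inner_sub_left, real_inner_smul_left, hv1, one_pow, mul_one] at this
  -- the leading mode
  have hu1 : ‖‖y‖⁻¹ • y‖ = 1 := by
    rw [norm_smul, norm_inv, norm_norm, inv_mul_cancel₀ hypos.ne']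
  have hcl : c ^ l = sigma1 A Z ^ l := by
    obtain ⟨j, rfl⟩ := hle
    rw [← two_mul, pow_mul, pow_mul, hc]
  have hxu : ⟪x₀, ‖y‖⁻¹ • y⟫ = ‖y‖ := by
    have : ⟪x₀, y⟫ = ‖y‖ ^ 2 := by
      rw [← real_inner_self_eq_norm_sq]
      conv_rhs => rw [hydef, hPs, hPP]
    rw [real_inner_smul_right, this]
    field_simp
  have hlead : ⟪lin l A Z η t x₀, rankOne l (‖y‖⁻¹ • y)⟫ = α ^ t * ‖y‖ ^ l := by
    rw [inner_lin_eigenvector hA (μ := c) (by rw [map_smul, hUP, smul_comm]), hxu, hcl]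
  have hlow : ε * α ^ t * ‖y‖ ^ l - δ ≤ ⟪w, rankOne l (‖y‖⁻¹ • y)⟫ := by
    have := (abs_le.1 (hclose _ hu1)).1
    rw [hlead] at this
    linarith
  have hone' := (hlow.trans (le_abs_self _)).trans (le_vEigRankOne_one w hu1)
  have hne : ⟪w, rankOne l (‖y‖⁻¹ • y)⟫ ≠ 0 := (hpos.trans_le hlow).ne'
  have hu0 : ‖y‖⁻¹ • y ≠ 0 := by
    rw [← norm_ne_zero_iff, hu1]; exact one_ne_zero
  refine ⟨vEig_one_pos hu0 hne, hpos.trans_le hone', ?_⟩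
  -- the second mode
  have hδ0 : 0 ≤ δ := by positivity
  refine le_trans (vEigRankOne_two_le (D := κ * (ε * α ^ t) * ‖x₀ - y‖ ^ l + δ) (by positivity)
    fun a b ha hb hab => ?_) (hfin.trans (mul_le_mul_of_nonneg_left hone' hκ.le))
  have ha0 : a ≠ 0 := by rintro rfl; simp at ha
  have hb0 : b ≠ 0 := by rintro rfl; simp at hb
  obtain ⟨v, hvS, hv1, hyv⟩ := exists_mem_span_inner_eq_zero ha0 hb0 hab y
    (S := Submodule.span ℝ {a, b}) (Submodule.subset_span (by simp))
    (Submodule.subset_span (by simp))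
  refine ⟨v, hvS, hv1, ?_⟩
  have hlin := abs_inner_lin_le (l := l) (A := A) (Z := Z) hη.le hσ2 hv1
    (fun x z => z = x - P x ∧ ∃ s : ℝ, P x = s • y)
    (by
      rintro x z ⟨rfl, s, hs⟩
      exact ⟨by rw [map_sub, hPU], c * s, by rw [hPU, hUP, hs, smul_smul]⟩)
    (by
      rintro x z ⟨rfl, s, hs⟩
      rw [inner_sub_left, hs, real_inner_smul_left, hyv, mul_zero, sub_zero])
    (by
      rintro x z ⟨rfl, -⟩
      exact hPσ _ (by rw [map_sub, hPP, sub_self]))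
    t (x := x₀) (z := x₀ - y) ⟨rfl, 1, by rw [one_smul]⟩
  have h1 := hclose v hv1
  have h2 : |ε * ⟪lin l A Z η t x₀, rankOne l v⟫| ≤ κ * (ε * α ^ t) * ‖x₀ - y‖ ^ l := by
    rw [abs_mul, abs_of_pos hε]
    calc _ ≤ ε * ((1 + 4 * η * sigma2 A Z ^ l) ^ t * ‖x₀ - y‖ ^ l) := by gcongr
      _ ≤ ε * (κ * α ^ t * ‖x₀ - y‖ ^ l) := by gcongr
      _ = _ := by ring
  have h3 := abs_add_le (ε * ⟪lin l A Z η t x₀, rankOne l v⟫)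
    (⟪w, rankOne l v⟫ - ε * ⟪lin l A Z η t x₀, rankOne l v⟫)
  rw [add_sub_cancel] at h3
  linarith

lemma odd_order_ae_pos {η ε : ℝ} (hA : ∀ k, (A k).IsSymm) (hl : 1 ≤ l) (hη : 0 < η)
    (hε : 0 < ε) (h : sigma2 A Z < sigma1 A Z) {ρ : ℝ≥0} (hρ : 0 < ρ)
    (v₁ : EuclideanSpace ℝ (Fin n × Fin r)) :
    ∀ᵐ g ∂isoGaussian (Fin n × Fin r) ρ, ∀ t : ℕ,
      0 < vEig 1 (gd l A Z η ε (v₁ + g) t) ∧ 0 < vEigRankOne 1 (gd l A Z η ε (v₁ + g) t) := by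
  obtain ⟨e, μ, he, hμ, hU⟩ := exists_pos_eigenvector_matU hA h
  have he0 : e ≠ 0 := by rintro rfl; simp at he
  refine (isoGaussian_absolutelyContinuous hρ.ne').ae_le (ae_all_iff.2 fun t => ?_)
  have h0 := volume_inner_gd_eq_zero hA hl hη hε.ne' hμ he hU t
  have h1 : volume ((v₁ + ·) ⁻¹' {x | ⟪gd l A Z η ε x t, rankOne l e⟫ = 0}) = 0 := by
    rw [measure_preimage_add, h0]
  filter_upwards [measure_eq_zero_iff_ae_notMem.1 h1] with g hg
  have hne : ⟪gd l A Z η ε (v₁ + g) t, rankOne l e⟫ ≠ 0 := hg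
  exact ⟨vEig_one_pos he0 hne, (abs_pos.2 hne).trans_le (le_vEigRankOne_one _ he)⟩

end Dynamics

end

end LiftedSensing

open LiftedSensing in
theorem mainTheorem8 :
    ∃ C c₁ c₂ γ : ℝ, 0 < C ∧ 0 < c₁ ∧ c₁ ≤ c₂ ∧ 1 < γ ∧
    ∀ (l : ℕ), 1 ≤ l → ∀ Λ : ℝ, 0 < Λ →
    ∃ a : ℝ, 0 < a ∧
    ∀ n r : ℕ, ∃ ρ₀ : ℝ≥0, 0 < ρ₀ ∧
    ∀ (m : ℕ) (A : Fin m → Matrix (Fin n) (Fin n) ℝ) (Z : Matrix (Fin n) (Fin r) ℝ)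
      (L η : ℝ) (v₁ : EuclideanSpace ℝ (Fin n × Fin r)),
      (∀ k, (A k).IsSymm) → RSS A Z L → L ≤ Λ → 0 < η →
      sigma2 A Z < sigma1 A Z → IsTopSingularVector A Z v₁ →
    ∃ θ : ℝ, c₁ ≤ θ ∧ θ ≤ c₂ ∧
    ∀ (κ ε : ℝ) (ρ : ℝ≥0), 0 < κ → κ < 1 → 0 < ρ → ρ ≤ ρ₀ →
      0 < ε → ε ≤ a * epsScale l A Z L η κ →
      1 - ENNReal.ofReal (2 * Real.exp (-C / ρ)) ≤
        isoGaussian (Fin n × Fin r) ρ {g | ∀ t : ℕ,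
          θ * timeScale l A Z η κ ≤ t → t ≤ ⌈γ * θ * timeScale l A Z η κ⌉₊ →
          (0 < vEig 1 (gd l A Z η ε (v₁ + g) t) ∧
            vEig 2 (gd l A Z η ε (v₁ + g) t) / vEig 1 (gd l A Z η ε (v₁ + g) t) ≤ κ) ∧
          (0 < vEigRankOne 1 (gd l A Z η ε (v₁ + g) t) ∧
            vEigRankOne 2 (gd l A Z η ε (v₁ + g) t) /
              vEigRankOne 1 (gd l A Z η ε (v₁ + g) t) ≤ κ)} := by
  refine ⟨1 / 128, 1 / 4, 1, 5 / 4, by norm_num, by norm_num, by norm_num, by norm_num,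
    fun l hl Λ hΛ => ⟨initFactor l Λ, initFactor_pos l hΛ, fun n r =>
      ⟨1 / (64 * (Fintype.card (Fin n × Fin r) + 1)), by positivity,
        fun m A Z L η v₁ hA hR hLΛ hη h hv => ?_⟩⟩⟩
  have hσ2 := sigma2_nonneg A Z
  have hs2 : 0 ≤ η * sigma2 A Z ^ l := by positivity
  have hlt : η * sigma2 A Z ^ l < η * sigma1 A Z ^ l :=
    mul_lt_mul_of_pos_left (pow_lt_pow_left₀ h hσ2 (by omega)) hη
  have hD1 := log_ratio_pos hs2 hlt
  have hD4 := hD1.trans_le (log_ratio_le_log_ratio_four hs2 hlt)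
  refine ⟨_, (le_div_iff₀ hD4).2 ?_, (div_le_one hD4).2 (log_ratio_le_log_ratio_four hs2 hlt),
    fun κ ε ρ hκ hκ1 hρ hρ₀ hε hε' => ?_⟩
  · linarith [log_ratio_four_le hs2 hlt]
  have htime : Real.log ((1 + η * sigma1 A Z ^ l) / (1 + η * sigma2 A Z ^ l)) /
      Real.log ((1 + 4 * (η * sigma1 A Z ^ l)) / (1 + 4 * (η * sigma2 A Z ^ l))) *
        timeScale l A Z η κ = Real.log (1 / κ) /
      Real.log ((1 + 4 * (η * sigma1 A Z ^ l)) / (1 + 4 * (η * sigma2 A Z ^ l))) := by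
    rw [timeScale]
    field_simp
  rw [mul_assoc (5 / 4), htime]
  have hT : 0 ≤ Real.log (1 / κ) /
      Real.log ((1 + 4 * (η * sigma1 A Z ^ l)) / (1 + 4 * (η * sigma2 A Z ^ l))) :=
    div_nonneg (Real.log_nonneg ((one_le_div hκ).2 hκ1.le)) hD4.le
  have hratio : ∀ w : Tensor l (Fin n × Fin r), 0 < vEig 1 w → vEig 2 w / vEig 1 w ≤ κ :=
    fun w hw => (div_nonpos_of_nonpos_of_nonneg (vEig_two_le_zero w) hw.le).trans hκ.le
  rcases Nat.even_or_odd l with hle | hlo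
  · refine one_sub_le_isoGaussian hρ hρ₀ fun g hg t ht1 ht2 => ?_
    have ht3 : (t : ℝ) ≤ 5 / 4 * (Real.log (1 / κ) / Real.log ((1 + 4 * (η * sigma1 A Z ^ l)) /
        (1 + 4 * (η * sigma2 A Z ^ l)))) + 1 := by
      have h1 : (t : ℝ) ≤ _ := Nat.cast_le.2 ht2
      exact h1.trans (Nat.ceil_lt_add_one (by positivity)).le
    obtain ⟨h1, h2, h3⟩ := even_order_bounds hA hR hl hle hη hκ hκ1 h hv hg hε ht1
      (correction_le hl (hR.pos h) hLΛ hη hκ hκ1 h hε hε' ht3)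
    exact ⟨⟨h1, hratio _ h1⟩, h2, (div_le_iff₀ h2).2 h3⟩
  · refine tsub_le_self.trans (le_of_eq (Eq.symm ?_))
    rw [← measure_univ (μ := isoGaussian (Fin n × Fin r) ρ)]
    refine measure_congr ?_
    filter_upwards [odd_order_ae_pos hA hl hη hε h hρ v₁] with g hg
    refine eq_true fun t _ _ => ?_
    obtain ⟨h1, h2⟩ := hg t
    exact ⟨⟨h1, hratio _ h1⟩, h2, (div_nonpos_of_nonpos_of_nonneg
      (vEigRankOne_two_le_zero hlo _) h2.le).trans hκ.le⟩
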